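/- Let $\sigma>0$, $0<\rho_0<1$, $\rho_1\ge 0$ with $\rho_0\rho_1<1$, and put $\hat\rho=\max\{1,\rho_1\}$ (with the convention $0^0=1$). A Motzkin path of length $L$ is a sequence $\gamma=(\gamma_0,\dots,\gamma_L)$ of non-negative integers with $|\gamma_j-\gamma_{j-1}|\le 1$ for $1\le j\le L$. Its edge weight is $w(\gamma)=\sigma^{h(\gamma)}$, where $h(\gamma)$ is the number of $j$ with $\gamma_j=\gamma_{j-1}$ (up and down steps have weight $1$, horizontal steps weight $\sigma$). Then for every $L$ the normalizing constant $\mathfrak C_L=\sum_\gamma \rho_0^{\gamma_0}\,w(\gamma)\,\rho_1^{\gamma_L}$, the sum being over all Motzkin paths of length $L$, is positive and finite, so that $\Pr_L(\gamma)=\rho_0^{\gamma_0}w(\gamma)\rho_1^{\gamma_L}/\mathfrak C_L$ defines a probability measure on Motzkin paths of length $L$. Let $(\gamma^{(L)}_0,\dots,\gamma^{(L)}_L)$ be sampled from $\Pr_L$ and set $\gamma^{(L)}_k=0$ for $k>L$. Then, as $L\to\infty$, $$\{\gamma^{(L)}_k\}_{k\ge 0}\Rightarrow\{Z_k\}_{k\ge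 0}$$ in law on $\mathbb Z_{\ge 0}^{\mathbb Z_{\ge 0}}$ with the product topology, where $\{Z_k\}_{k\ge 0}$ is the Markov chain on $\mathbb Z_{\ge 0}$ with transition probabilities $\mathsf Q^{(\hat\rho)}_{n,m}$. Here, for $\rho>1$, $$\mathsf Q^{(\rho)}_{n,m}=\frac{1}{\rho+1/\rho+\sigma}\begin{cases}\dfrac{\rho^{n+2}-\rho^{-(n+2)}}{\rho^{n+1}-\rho^{-(n+1)}},& m=n+1,\\ \sigma,& m=n,\\ \dfrac{\rho^{n}-\rho^{-n}}{\rho^{n+1}-\rho^{-(n+1)}},& m=n-1\ge 0,\\ 0,&\text{otherwise,}\end{cases}$$ and for $\rho=1$ (the limit $\rho\to1$) $$\mathsf Q^{(1)}_{n,m}=\frac{1}{2+\sigma}\begin{cases}\dfrac{n+2}{n+1},& m=n+1,\\ \sigma,& m=n,\\ \dfrac{n}{n+1},& m=n-1\ge 0,\\ 0,&\text{otherwise.}\end{cases}$$ The initial state $Z_0$ is distributed as $G_{\rho_0\hat\rho}+\widetilde G_{\rho_0/\hat\rho}$, a sum of two independent geometric random variables, where $\Pr(G_p=n)=(1-p)p^n$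 for $n\ge 0$, $0<p<1$. (So the limit does not depend on $\rho_1$ for $\rho_1\le1$, and is governed by $\hat\rho=\rho_1$ for $\rho_1>1$: the phase transition at $\rho_1=1$.) -/

import Mathlib

open MeasureTheory ProbabilityTheory Filter Topology
open scoped ENNReal

namespace Motzkin

/-- Motzkin paths of length `L`: altitudes `γ 0, …, γ L` in `ℕ` with `|γ (j+1) - γ j| ≤ 1`;
both end points are free. -/
def MotzkinPath (L : ℕ) : Type :=
  {γ : Fin (L + 1) → ℕ //
    ∀ j : Fin L, γ j.succ ≤ γ j.castSucc + 1 ∧ γ j.castSucc ≤ γ j.succ + 1}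

/-- Weight of a single edge from altitude `n` to altitude `m` (with `|m - n| ≤ 1`), where
`a`, `b`, `c` are the weights of up, horizontal and down steps, indexed by the altitude of the
left end of the edge. -/
def edgeWeight (a b c : ℕ → ℝ) (n m : ℕ) : ℝ :=
  if n < m then a n else if m < n then c n else b n

/-- The edge weight `w(γ)` of a path. -/
def pathWeight (a b c : ℕ → ℝ) {L : ℕ} (γ : MotzkinPath L) : ℝ :=
  ∏ j : Fin L, edgeWeight a b c (γ.1 j.castSucc) (γ.1 j.succ)

/-- The total weight `α_{γ_0} w(γ) β_{γ_L}` of a path, as an extended nonnegative real. -/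
noncomputable def totalWeight (a b c α β : ℕ → ℝ) (L : ℕ) (γ : MotzkinPath L) : ℝ≥0∞ :=
  ENNReal.ofReal (α (γ.1 0) * pathWeight a b c γ * β (γ.1 (Fin.last L)))

/-- The normalizing constant: the sum (possibly infinite) of the weights of all paths of
length `L`. -/
noncomputable def normConst (a b c α β : ℕ → ℝ) (L : ℕ) : ℝ≥0∞ :=
  ∑' γ : MotzkinPath L, totalWeight a b c α β L γ

/-- The probability measure `Pr_L` on paths of length `L`, with masses `weight / normConst`. -/
noncomputable def pathPMF (a b c α β : ℕ → ℝ) (L : ℕ)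
    (h : normConst a b c α β L ≠ 0 ∧ normConst a b c α β L ≠ ∞) : PMF (MotzkinPath L) :=
  PMF.normalize (totalWeight a b c α β L) h.1 h.2

/-- The infinite sequence `γ_0, …, γ_L, 0, 0, …` attached to a path of length `L`. -/
def extend {L : ℕ} (γ : MotzkinPath L) : ℕ → ℕ :=
  fun k => if h : k < L + 1 then γ.1 ⟨k, h⟩ else 0

/-- The law on `ℕ → ℕ` of the left boundary process `(γ_k)_{k ≥ 0}` of a random Motzkin path
of length `L`. -/
noncomputable def leftBoundaryLaw (a b c α β : ℕ → ℝ) (L : ℕ)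
    (h : normConst a b c α β L ≠ 0 ∧ normConst a b c α β L ≠ ∞) :
    ProbabilityMeasure (ℕ → ℕ) :=
  ⟨((pathPMF a b c α β L h).map extend).toMeasure, inferInstance⟩

/-- The kernel `P_{n,m}`, the value at `ρ = 1` (a removable singularity) of `kernelQ`. -/
noncomputable def kernelP (σ : ℝ) (n m : ℕ) : ℝ :=
  if m = n + 1 then 1 / (2 + σ) * (((n : ℝ) + 2) / ((n : ℝ) + 1))
  else if m = n then σ / (2 + σ)
  else if m + 1 = n then 1 / (2 + σ) * ((n : ℝ) / ((n : ℝ) + 1))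
  else 0

/-- The kernel `Q^{(ρ)}_{n,m}`. -/
noncomputable def kernelQ (σ ρ : ℝ) (n m : ℕ) : ℝ :=
  if ρ = 1 then kernelP σ n m
  else if m = n + 1 then
    1 / (ρ + 1 / ρ + σ) *
      ((ρ ^ (n + 2) - 1 / ρ ^ (n + 2)) / (ρ ^ (n + 1) - 1 / ρ ^ (n + 1)))
  else if m = n then 1 / (ρ + 1 / ρ + σ) * σ
  else if m + 1 = n then
    1 / (ρ + 1 / ρ + σ) * ((ρ ^ n - 1 / ρ ^ n) / (ρ ^ (n + 1) - 1 / ρ ^ (n + 1)))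
  else 0

/-- `Z` is a Markov chain on `ℕ` under `P` with (stochastic) transition matrix `Q`:
`P (Z_0 = x_0, …, Z_{k+1} = x_{k+1}) = P (Z_0 = x_0, …, Z_k = x_k) * Q_{x_k, x_{k+1}}`. -/
structure IsMarkovChain {Ω : Type*} [MeasurableSpace Ω] (P : Measure Ω) (Z : ℕ → Ω → ℕ)
    (Q : ℕ → ℕ → ℝ) : Prop where
  measurable : ∀ k, Measurable (Z k)
  nonneg : ∀ n m, 0 ≤ Q n m
  row_sum : ∀ n, HasSum (Q n) 1
  step : ∀ (k : ℕ) (x : ℕ → ℕ),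
    P {ω | ∀ i ≤ k + 1, Z i ω = x i} =
      P {ω | ∀ i ≤ k, Z i ω = x i} * ENNReal.ofReal (Q (x k) (x (k + 1)))

/-- The law of a geometric variable `G_p`: `Pr (G_p = n) = (1 - p) p ^ n` for `n ≥ 0`. -/
noncomputable def geomLaw (p : ℝ) : Measure ℕ :=
  Measure.sum fun n : ℕ => ENNReal.ofReal ((1 - p) * p ^ n) • Measure.dirac n

/-- `geomLaw p` is the geometric law with success probability `1 - p`. -/
theorem geomLaw_eq (p : ℝ) (h0 : 0 < p) (h1 : p < 1) :
    geomLaw p = geometricMeasure ⟨1 - p, by constructor <;> linarith⟩ := by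
  rw [geometricMeasure_eq (by
    intro h
    have := congrArg Subtype.val h
    simp at this
    linarith)]
  simp [geomLaw, mul_comm]

end Motzkin

/-!
The law of the first `k + 1` altitudes of a random path is
`ρ₀ ^ x₀ * ∏ A (xᵢ, xᵢ₊₁) * (A ^ (L - k) r) (x_k) / C_L`, where `A` is the transfer operator
(`transfer`), `r n = ρ₁ ^ n` and `C_L = ∑ n, ρ₀ ^ n * (A ^ L r) n` is the normalizing constant
(`leftBoundaryLaw_cylinder`, `normConst_eq`). Everything rests on the ratio limit
`C_(L+1) / C_L → λ`, with `λ = ρ + 1 / ρ + σ` for `ρ = max 1 ρ₁` (`tendsto_partition_ratio`).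

Once this is known, summation by parts gives `C_(L+1) = (ρ₀ + 1 / ρ₀ + σ) C_L - (A ^ L r) 0 / ρ₀`,
hence the limit of `(A ^ L r) 0 / C_L`, and the three-term recurrence `A ^ (L+1) r = A (A ^ L r)`
propagates it to `(A ^ L r) n / C_L → K * h n`, where `h` is the positive harmonic function
`harmonic` with `A h = λ h` (`tendsto_endSum_div_partition`). So the cylinder probabilities
converge to those of the Doob transform of `A` by `h`, which is the kernel `Q` (`kernelQ_eq`),
started from the law proportional to `ρ₀ ^ n * h n`, which is the convolution of the two geometric
laws (`map_add_geomLaw_singleton`). Cylinders form a convergence determining class, and the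
limiting chain exists by the Ionescu-Tulcea theorem.

The ratio limit is first proved for the weights `M_L = (A ^ L δ₀) 0` of returns to `0`, which are
the integrals of `(σ + 2 cos θ) ^ L` against `(2 / π) sin² θ dθ` on `[0, π]`: since `σ > 0`, the
upper end point `2 + σ` strictly dominates the spectrum in absolute value
(`tendsto_returns_ratio`). Since `ρ ^ n` is an eigenfunction of `A` except at `n = 0`, attaching a
boundary weight `ρ ^ n` to an end point of the path turns a sequence `y` into a solution of
`x_(L+1) = μ x_L - y_L / ρ`, with `μ = ρ + 1 / ρ + σ`. If `x_L / μ ^ L → 0` then `x` has the same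
ratio limit as `y` (`tendsto_ratio_of_recurrence`); if the limit is positive, the ratio limit is
`μ`. The first case occurs for the weight `ρ₀ < 1` and for `0 < ρ₁ < 1`, the second for `ρ₁ > 1`;
for `ρ₁ = 0` one has `r = δ₀`, with nothing to attach; for `ρ₁ = 1` one has `μ = 2 + σ` and both
give the same answer.
-/

namespace Motzkin

/-! ### Ratio limits of positive sequences -/

lemma tendsto_ratio_iff {x : ℕ → ℝ} (hx : ∀ L, 0 < x L) (l : ℝ) :
    Tendsto (fun L => x (L + 1) / x L) atTop (𝓝 l) ↔
      ∀ ε > 0, ∀ᶠ L in atTop, |x (L + 1) - l * x L| ≤ ε * x L := by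
  have key : ∀ ε L, |x (L + 1) - l * x L| ≤ ε * x L ↔ dist (x (L + 1) / x L) l ≤ ε := by
    intro ε L
    have h : x (L + 1) - l * x L = (x (L + 1) / x L - l) * x L := by
      have := (hx L).ne'
      field_simp
    rw [h, abs_mul, abs_of_pos (hx L), Real.dist_eq]
    exact mul_le_mul_iff_left₀ (hx L)
  simp only [key]
  constructor
  · intro h ε hε
    filter_upwards [Metric.tendsto_nhds.1 h ε hε] with L hL using hL.le
  · intro h
    refine Metric.tendsto_nhds.2 fun ε hε => ?_
    filter_upwards [h (ε / 2) (by positivity)] with L hL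
    linarith

/-- A sequence with `e (L + 1) ≤ μ e L` and `e L = o(μ ^ L)` is nonnegative, since `e L / μ ^ L`
decreases to `0`. -/
lemma nonneg_of_succ_le_mul {e : ℕ → ℝ} {μ : ℝ} (hμ : 0 < μ) {L₀ : ℕ}
    (he : ∀ L ≥ L₀, e (L + 1) ≤ μ * e L) (h0 : Tendsto (fun L => e L / μ ^ L) atTop (𝓝 0))
    {L : ℕ} (hL : L₀ ≤ L) : 0 ≤ e L := by
  have hanti : Antitone fun k => e (L + k) / μ ^ (L + k) := by
    refine antitone_nat_of_succ_le fun k => ?_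
    have := he (L + k) (by omega)
    rw [← add_assoc, pow_succ, div_le_div_iff₀ (by positivity) (by positivity)]
    have hp : 0 < μ ^ (L + k) := by positivity
    nlinarith
  have hlim : Tendsto (fun k => e (L + k) / μ ^ (L + k)) atTop (𝓝 0) :=
    h0.comp (tendsto_add_atTop_nat L |>.congr fun k => by simp [add_comm])
  have := hanti.le_of_tendsto hlim 0
  simp only [add_zero] at this
  by_contra hneg
  have : e L / μ ^ L < 0 := div_neg_of_neg_of_pos (not_le.1 hneg) (by positivity)
  linarith

/-- If `x (L + 1) = μ x L - c y L` and `x L = o(μ ^ L)`, then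
`x L = c ∑ k, y (L + k) / μ ^ (k + 1)`, so that `x` inherits the ratio limit of `y`. The proof
avoids the series and compares solutions of the recurrence. -/
lemma tendsto_ratio_of_recurrence {x y : ℕ → ℝ} {μ c l : ℝ} (hμ : 0 < μ) (hc : 0 ≤ c)
    (hx : ∀ L, 0 < x L) (hy : ∀ L, 0 < y L) (hrec : ∀ L, x (L + 1) = μ * x L - c * y L)
    (h0 : Tendsto (fun L => x L / μ ^ L) atTop (𝓝 0))
    (hl : Tendsto (fun L => y (L + 1) / y L) atTop (𝓝 l)) :
    Tendsto (fun L => x (L + 1) / x L) atTop (𝓝 l) := by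
  rw [tendsto_ratio_iff hy] at hl
  rw [tendsto_ratio_iff hx]
  intro ε hε
  obtain ⟨L₀, hL₀⟩ := eventually_atTop.1 (hl ε hε)
  have h1 : Tendsto (fun L => x (L + 1) / μ ^ L) atTop (𝓝 0) := by
    have := ((tendsto_add_atTop_iff_nat 1).2 h0).mul_const μ
    rw [zero_mul] at this
    refine this.congr fun L => ?_
    rw [pow_succ]
    field_simp
  have hd : Tendsto (fun L => (x (L + 1) - l * x L) / μ ^ L) atTop (𝓝 0) := by
    have := h1.sub (h0.const_mul l)
    rw [mul_zero, sub_zero] at this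
    exact this.congr fun L => by ring
  filter_upwards [eventually_ge_atTop L₀] with L hL
  -- For both signs `s`, the gap solves the recurrence with a source term of constant sign.
  have key : ∀ s : ℝ, |s| = 1 → 0 ≤ ε * x L - s * (x (L + 1) - l * x L) := by
    intro s hs
    refine nonneg_of_succ_le_mul (e := fun L => ε * x L - s * (x (L + 1) - l * x L)) hμ
      (fun L hL => ?_) ?_ hL
    · have h2 : s * (y (L + 1) - l * y L) ≤ ε * y L :=
        ((le_abs_self _).trans_eq (by rw [abs_mul, hs, one_mul])).trans (hL₀ L hL)
      rw [hrec (L + 1), hrec L]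
      nlinarith [mul_le_mul_of_nonneg_left h2 hc, hrec L]
    · have := (h0.const_mul ε).sub (hd.const_mul s)
      rw [mul_zero, mul_zero, sub_zero] at this
      exact this.congr fun L => by ring
  have ha := key 1 (by simp)
  have hb := key (-1) (by simp)
  rw [abs_le]
  constructor <;> linarith

lemma tendsto_ratio_of_tendsto_div_pow {x : ℕ → ℝ} {μ l : ℝ} (hμ : 0 < μ) (hl : l ≠ 0)
    (h : Tendsto (fun L => x L / μ ^ L) atTop (𝓝 l)) :
    Tendsto (fun L => x (L + 1) / x L) atTop (𝓝 μ) := by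
  have := (((tendsto_add_atTop_iff_nat 1).2 h).div h hl).const_mul μ
  rw [div_self hl, mul_one] at this
  refine this.congr fun L => ?_
  simp only [Pi.div_apply]
  rw [pow_succ, div_div_div_eq]
  have : μ ^ L ≠ 0 := by positivity
  by_cases hx : x L = 0
  · simp [hx]
  · field_simp

/-- A positive sequence with `x (L + 1) ≤ μ x L` is asymptotic to a multiple of `μ ^ L`. -/
lemma exists_tendsto_div_pow {x : ℕ → ℝ} {μ b : ℝ} (hμ : 0 < μ)
    (hb : ∀ L, b * μ ^ L ≤ x L) (hrec : ∀ L, x (L + 1) ≤ μ * x L) :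
    ∃ l, b ≤ l ∧ Tendsto (fun L => x L / μ ^ L) atTop (𝓝 l) := by
  have hanti : Antitone fun L => x L / μ ^ L := by
    refine antitone_nat_of_succ_le fun k => ?_
    rw [pow_succ, div_le_div_iff₀ (by positivity) (by positivity)]
    have hp : 0 < μ ^ k := by positivity
    nlinarith [hrec k]
  have hge : ∀ L, b ≤ x L / μ ^ L := fun L => (le_div_iff₀ (by positivity)).2 (hb L)
  have hlim := tendsto_atTop_ciInf hanti ⟨b, by rintro _ ⟨L, rfl⟩; exact hge L⟩
  exact ⟨_, le_ciInf hge, hlim⟩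

/-! ### The transfer operator -/

/-- The transfer operator of weighted Motzkin paths: `(transfer σ f) n` sums `f` over the
neighbours of `n` in `ℕ`, up and down steps having weight `1` and horizontal steps weight `σ`. -/
noncomputable def transfer (σ : ℝ) : Module.End ℝ (ℕ → ℝ) where
  toFun f n := f (n + 1) + σ * f n + (if n = 0 then 0 else f (n - 1))
  map_add' f g := by
    ext n
    by_cases h : n = 0 <;> simp [h] <;> ring
  map_smul' c f := by
    ext n
    by_cases h : n = 0 <;> simp [h] <;> ring

variable {σ ρ ρ₀ ρ₁ : ℝ}

lemma transfer_apply_zero (f : ℕ → ℝ) : transfer σ f 0 = f 1 + σ * f 0 := by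
  simp [transfer]

lemma transfer_apply_succ (f : ℕ → ℝ) (n : ℕ) :
    transfer σ f (n + 1) = f (n + 2) + σ * f (n + 1) + f n := by
  simp [transfer]

lemma transfer_nonneg (hσ : 0 < σ) {f : ℕ → ℝ} (hf : 0 ≤ f) : 0 ≤ transfer σ f := by
  intro n
  have h := fun k => hf k
  simp only [Pi.zero_apply] at h
  cases n with
  | zero =>
    rw [transfer_apply_zero]
    have := h 1; have := h 0
    simp only [Pi.zero_apply]
    positivity
  | succ n =>
    rw [transfer_apply_succ]
    have := h (n + 2); have := h (n + 1); have := h n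
    simp only [Pi.zero_apply]
    positivity

lemma transfer_mono (hσ : 0 < σ) {f g : ℕ → ℝ} (h : f ≤ g) : transfer σ f ≤ transfer σ g := by
  have := transfer_nonneg hσ (sub_nonneg.2 h)
  rwa [map_sub, sub_nonneg] at this

lemma transfer_pow_mono (hσ : 0 < σ) {f g : ℕ → ℝ} (h : f ≤ g) (L : ℕ) :
    (transfer σ ^ L) f ≤ (transfer σ ^ L) g := by
  induction L with
  | zero => simpa using h
  | succ L ih => rw [pow_succ']; exact transfer_mono hσ ih

lemma transfer_pow_nonneg (hσ : 0 < σ) {f : ℕ → ℝ} (hf : 0 ≤ f) (L : ℕ) :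
    0 ≤ (transfer σ ^ L) f := by
  simpa using transfer_pow_mono hσ hf L

lemma smul_le_transfer {f : ℕ → ℝ} (hf : 0 ≤ f) : σ • f ≤ transfer σ f := by
  intro n
  have h := fun k => hf k
  simp only [Pi.zero_apply] at h
  cases n with
  | zero => simpa [transfer_apply_zero] using h 1
  | succ n =>
    rw [transfer_apply_succ, Pi.smul_apply, smul_eq_mul]
    linarith [h (n + 2), h n]

lemma pow_smul_le_transfer_pow (hσ : 0 < σ) {f : ℕ → ℝ} (hf : 0 ≤ f) (L : ℕ) :
    σ ^ L • f ≤ (transfer σ ^ L) f := by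
  induction L with
  | zero => simp
  | succ L ih =>
    rw [pow_succ' (transfer σ)]
    refine le_trans ?_ (smul_le_transfer (transfer_pow_nonneg hσ hf L))
    rw [pow_succ', mul_smul]
    exact smul_le_smul_of_nonneg_left ih hσ.le

/-- The growth rate `ρ + 1 / ρ + σ`, the value for which `ρ ^ n` satisfies the eigenvalue equation
of the transfer operator away from `0`. -/
noncomputable def growth (σ ρ : ℝ) : ℝ := ρ + 1 / ρ + σ

lemma growth_pos (hσ : 0 < σ) (hρ : 0 < ρ) : 0 < growth σ ρ := by
  unfold growth; positivity

lemma growth_one : growth σ 1 = 2 + σ := by norm_num [growth]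

lemma two_add_lt_growth (hρ : 0 < ρ) (h1 : ρ ≠ 1) : 2 + σ < growth σ ρ := by
  have : ρ + 1 / ρ - 2 = (ρ - 1) ^ 2 / ρ := by field_simp; ring
  have : 0 < (ρ - 1) ^ 2 / ρ := by
    have := sub_ne_zero.2 h1
    positivity
  unfold growth
  linarith

lemma transfer_geom (hρ : ρ ≠ 0) :
    transfer σ (fun n => ρ ^ n) =
      growth σ ρ • (fun n => ρ ^ n) - ρ⁻¹ • (Pi.single 0 1 : ℕ → ℝ) := by
  ext n
  cases n with
  | zero =>
    simp [transfer_apply_zero, growth]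
    ring
  | succ n =>
    simp [transfer_apply_succ, growth]
    field_simp
    ring

lemma transfer_pow_succ_geom (hρ : ρ ≠ 0) (L : ℕ) :
    (transfer σ ^ (L + 1)) (fun n => ρ ^ n) =
      growth σ ρ • (transfer σ ^ L) (fun n => ρ ^ n) -
        ρ⁻¹ • (transfer σ ^ L) (Pi.single 0 1 : ℕ → ℝ) := by
  rw [pow_succ, Module.End.mul_apply, transfer_geom hρ, map_sub, map_smul, map_smul]

lemma single_nonneg : (0 : ℕ → ℝ) ≤ Pi.single 0 1 := by
  simp [Pi.single_nonneg]

lemma transfer_pow_geom_le (hσ : 0 < σ) (hρ : 0 < ρ) (L : ℕ) :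
    (transfer σ ^ L) (fun n => ρ ^ n) ≤ growth σ ρ ^ L • fun n => ρ ^ n := by
  induction L with
  | zero => simp
  | succ L ih =>
    rw [transfer_pow_succ_geom hρ.ne']
    intro n
    have h1 := ih n
    have h2 := transfer_pow_nonneg hσ single_nonneg L n
    have h3 := growth_pos hσ hρ
    simp only [Pi.sub_apply, Pi.smul_apply, smul_eq_mul, Pi.zero_apply] at h1 h2 ⊢
    have h4 := mul_le_mul_of_nonneg_left h1 h3.le
    have h5 : 0 ≤ ρ⁻¹ * (transfer σ ^ L) (Pi.single 0 1) n := by positivity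
    rw [pow_succ']
    linarith

/-- The positive harmonic function `∑_{i + j = n} ρ ^ (i - j)` of the transfer operator, with
eigenvalue `growth σ ρ`; it equals `n + 1` for `ρ = 1`. -/
noncomputable def harmonic (ρ : ℝ) (n : ℕ) : ℝ :=
  ∑ p ∈ Finset.HasAntidiagonal.antidiagonal n, ρ ^ p.1 * (1 / ρ) ^ p.2

lemma harmonic_zero : harmonic ρ 0 = 1 := by simp [harmonic]

lemma harmonic_succ (n : ℕ) : harmonic ρ (n + 1) = ρ * harmonic ρ n + (1 / ρ) ^ (n + 1) := by
  rw [harmonic, Finset.Nat.antidiagonal_succ, Finset.sum_cons, Finset.sum_map, harmonic,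
    Finset.mul_sum, add_comm]
  simp [pow_succ', mul_assoc]

lemma harmonic_add_two (hρ : ρ ≠ 0) (n : ℕ) :
    harmonic ρ (n + 2) = (ρ + 1 / ρ) * harmonic ρ (n + 1) - harmonic ρ n := by
  rw [harmonic_succ (n + 1), harmonic_succ n, one_div_pow, one_div_pow]
  field_simp
  ring

lemma harmonic_pos (hρ : 0 < ρ) (n : ℕ) : 0 < harmonic ρ n := by
  induction n with
  | zero => simp [harmonic_zero]
  | succ n ih => rw [harmonic_succ]; positivity

lemma transfer_harmonic (hρ : ρ ≠ 0) : transfer σ (harmonic ρ) = growth σ ρ • harmonic ρ := by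
  ext n
  cases n with
  | zero => simp [transfer_apply_zero, harmonic_succ, harmonic_zero, growth]
  | succ n =>
    simp only [transfer_apply_succ, harmonic_add_two hρ, growth, Pi.smul_apply, smul_eq_mul]
    ring

lemma transfer_pow_harmonic (hρ : ρ ≠ 0) (L : ℕ) :
    (transfer σ ^ L) (harmonic ρ) = growth σ ρ ^ L • harmonic ρ := by
  induction L with
  | zero => simp
  | succ L ih =>
    rw [pow_succ', Module.End.mul_apply, ih, map_smul, transfer_harmonic hρ, smul_smul, pow_succ]

lemma harmonic_one (n : ℕ) : harmonic 1 n = n + 1 := by simp [harmonic]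

lemma harmonic_mul_sub (hρ : ρ ≠ 0) (n : ℕ) :
    harmonic ρ n * (ρ - 1 / ρ) = ρ ^ (n + 1) - 1 / ρ ^ (n + 1) := by
  induction n with
  | zero => simp [harmonic_zero]
  | succ n ih =>
    rw [harmonic_succ, add_mul, mul_assoc, ih, one_div_pow]
    field_simp
    ring

/-- For `ρ > 1` the harmonic function is dominated by a multiple of `ρ ^ n`. -/
lemma harmonic_le (hρ : 1 < ρ) (n : ℕ) : (1 - 1 / ρ ^ 2) * harmonic ρ n ≤ ρ ^ n := by
  have h0 : 0 < ρ := by linarith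
  have h := harmonic_mul_sub h0.ne' n
  have h2 : (1 - 1 / ρ ^ 2) * harmonic ρ n = (harmonic ρ n * (ρ - 1 / ρ)) / ρ := by
    field_simp
  rw [h2, h, div_le_iff₀ h0, ← pow_succ]
  have : 0 < 1 / ρ ^ (n + 1) := by positivity
  linarith

/-! ### The spectral representation of returns to the origin -/

lemma integral_sin_mul_sin (n : ℕ) :
    ∫ θ in (0 : ℝ)..Real.pi, Real.sin ((n + 1) * θ) * Real.sin θ =
      Real.pi / 2 * (Pi.single 0 1 : ℕ → ℝ) n := by
  cases n with
  | zero =>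
    have h : (fun θ : ℝ => Real.sin (((0 : ℕ) + 1) * θ) * Real.sin θ) =
        fun θ => Real.sin θ ^ 2 := by
      ext θ; simp [sq]
    rw [h, integral_sin_sq]
    simp
  | succ n =>
    have hcos : ∀ k : ℕ, ∫ θ in (0 : ℝ)..Real.pi, Real.cos ((k + 1 : ℝ) * θ) = 0 := by
      intro k
      have hk : (k + 1 : ℝ) ≠ 0 := by positivity
      rw [intervalIntegral.integral_comp_mul_left _ hk, integral_cos]
      have := Real.sin_nat_mul_pi (k + 1)
      push_cast at this
      simp [this]
    have h : (fun θ : ℝ => Real.sin (((n + 1 : ℕ) + 1) * θ) * Real.sin θ) =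
        fun θ => 1 / 2 * Real.cos ((n + 1 : ℝ) * θ) -
          1 / 2 * Real.cos (((n + 2 : ℕ) + 1 : ℝ) * θ) := by
      ext θ
      have e1 : (n + 1 : ℝ) * θ = (n + 2) * θ - θ := by ring
      have e2 : ((n + 2 : ℕ) + 1 : ℝ) * θ = (n + 2) * θ + θ := by push_cast; ring
      have e3 : ((n + 1 : ℕ) + 1 : ℝ) * θ = (n + 2) * θ := by push_cast; ring
      rw [e1, e2, e3, Real.cos_sub, Real.cos_add]
      ring
    rw [h, intervalIntegral.integral_sub
      (Continuous.intervalIntegrable (by fun_prop) _ _)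
      (Continuous.intervalIntegrable (by fun_prop) _ _),
      intervalIntegral.integral_const_mul, intervalIntegral.integral_const_mul, hcos n,
      hcos (n + 2)]
    simp

/-- Integral representation of `transfer σ ^ L`: the functions `n ↦ sin ((n + 1) θ)` are
generalized eigenfunctions with eigenvalues `σ + 2 cos θ`, and they vanish at `n = -1`. -/
lemma transfer_pow_single_eq_integral (L n : ℕ) :
    (transfer σ ^ L) (Pi.single 0 1) n = 2 / Real.pi *
      ∫ θ in (0 : ℝ)..Real.pi,
        (σ + 2 * Real.cos θ) ^ L * (Real.sin ((n + 1) * θ) * Real.sin θ) := by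
  induction L generalizing n with
  | zero =>
    simp only [pow_zero, Module.End.one_apply, one_mul, integral_sin_mul_sin]
    have := Real.pi_ne_zero
    field_simp
  | succ L ih =>
    have hi : ∀ k : ℕ, IntervalIntegrable (fun θ : ℝ =>
        (σ + 2 * Real.cos θ) ^ L * (Real.sin ((k + 1) * θ) * Real.sin θ)) volume 0 Real.pi :=
      fun k => Continuous.intervalIntegrable (by fun_prop) _ _
    rw [pow_succ', Module.End.mul_apply]
    cases n with
    | zero =>
      rw [transfer_apply_zero, ih, ih, mul_left_comm, ← mul_add,
        ← intervalIntegral.integral_const_mul, ← intervalIntegral.integral_add (hi 1)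
          ((hi 0).const_mul σ)]
      congr 2
      ext θ
      have e : ((1 : ℕ) + 1 : ℝ) * θ = 2 * θ := by push_cast; ring
      rw [e, Real.sin_two_mul]
      simp
      ring
    | succ n =>
      rw [transfer_apply_succ, ih, ih, ih, mul_left_comm, ← mul_add, ← mul_add,
        ← intervalIntegral.integral_const_mul, ← intervalIntegral.integral_add (hi (n + 2))
          ((hi (n + 1)).const_mul σ), ← intervalIntegral.integral_add
          ((hi (n + 2)).add ((hi (n + 1)).const_mul σ)) (hi n)]
      congr 2
      ext θ
      have e1 : ((n + 2 : ℕ) + 1 : ℝ) * θ = (n + 2) * θ + θ := by push_cast; ring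
      have e2 : ((n + 1 : ℕ) + 1 : ℝ) * θ = (n + 2) * θ := by push_cast; ring
      have e3 : (n + 1 : ℝ) * θ = (n + 2) * θ - θ := by ring
      rw [e1, e2, e3, Real.sin_add, Real.sin_sub]
      ring

/-- The total weight of the paths of length `L` from `0` to `0`. -/
noncomputable def returns (σ : ℝ) (L : ℕ) : ℝ := (transfer σ ^ L) (Pi.single 0 1) 0

lemma returns_pos (hσ : 0 < σ) (L : ℕ) : 0 < returns σ L := by
  have := pow_smul_le_transfer_pow hσ single_nonneg L 0
  simp only [Pi.smul_apply, Pi.single_eq_same, smul_eq_mul, mul_one] at this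
  exact lt_of_lt_of_le (by positivity) this

lemma returns_eq_integral (L : ℕ) :
    returns σ L = 2 / Real.pi *
      ∫ θ in (0 : ℝ)..Real.pi, (σ + 2 * Real.cos θ) ^ L * Real.sin θ ^ 2 := by
  rw [returns, transfer_pow_single_eq_integral]
  simp [sq]

/-- The part of the spectrum close to its upper end point `2 + σ` carries positive mass. -/
lemma returns_ge {b : ℝ} (hb0 : |σ - 2| < b) (hb : b < 2 + σ) :
    ∃ κ > 0, ∀ L, κ * b ^ L - |σ - 2| ^ L ≤ returns σ L := by
  have hb0' : 0 < b := (abs_nonneg _).trans_lt hb0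
  have hpi := Real.pi_pos
  -- `φ` is a continuous minorant of the indicator function of `b ≤ σ + 2 cos θ`.
  set φ : ℝ → ℝ := fun θ => max 0 ((σ + 2 * Real.cos θ - b) / 4) with hφ
  have hφc : Continuous φ := by fun_prop
  refine ⟨2 / Real.pi * ∫ θ in (0 : ℝ)..Real.pi, φ θ * Real.sin θ ^ 2, ?_, fun L => ?_⟩
  · refine mul_pos (by positivity) ?_
    refine intervalIntegral.integral_pos hpi (by fun_prop) (fun θ _ => ?_) ?_
    · have : 0 ≤ φ θ := le_max_left _ _
      positivity
    · have hlim : Tendsto (fun θ : ℝ => σ + 2 * Real.cos θ) (𝓝[>] 0) (𝓝 (2 + σ)) := by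
        have : Continuous fun θ : ℝ => σ + 2 * Real.cos θ := by fun_prop
        have := (this.tendsto 0).mono_left (nhdsWithin_le_nhds (s := Set.Ioi 0))
        simpa [add_comm] using this
      have h1 := hlim.eventually (lt_mem_nhds hb)
      have h2 : ∀ᶠ θ in 𝓝[>] (0 : ℝ), θ ∈ Set.Ioo 0 Real.pi := Ioo_mem_nhdsGT hpi
      obtain ⟨θ, hθ1, hθ2⟩ := (h1.and h2).exists
      refine ⟨θ, ⟨hθ2.1.le, hθ2.2.le⟩, ?_⟩
      have hs := Real.sin_pos_of_pos_of_lt_pi hθ2.1 hθ2.2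
      have : 0 < φ θ := lt_max_of_lt_right (by linarith)
      positivity
  · have hsin : ∫ θ in (0 : ℝ)..Real.pi, Real.sin θ ^ 2 = Real.pi / 2 := by
      rw [integral_sin_sq]; simp
    have hconst : |σ - 2| ^ L = 2 / Real.pi *
        ∫ θ in (0 : ℝ)..Real.pi, |σ - 2| ^ L * Real.sin θ ^ 2 := by
      rw [intervalIntegral.integral_const_mul, hsin]
      field_simp
    rw [returns_eq_integral, hconst, mul_right_comm, mul_assoc, ← mul_sub,
      ← intervalIntegral.integral_const_mul, ← intervalIntegral.integral_sub
        (Continuous.intervalIntegrable (by fun_prop) _ _)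
        (Continuous.intervalIntegrable (by fun_prop) _ _)]
    refine mul_le_mul_of_nonneg_left ?_ (by positivity)
    refine intervalIntegral.integral_mono_on hpi.le
      (Continuous.intervalIntegrable (by fun_prop) _ _)
      (Continuous.intervalIntegrable (by fun_prop) _ _) fun θ _ => ?_
    rw [← mul_assoc, ← sub_mul]
    refine mul_le_mul_of_nonneg_right ?_ (by positivity)
    have hc1 := Real.neg_one_le_cos θ
    have hc2 := Real.cos_le_one θ
    rcases le_total b (σ + 2 * Real.cos θ) with h | h
    · have h1 : φ θ ≤ 1 := max_le zero_le_one (by linarith [abs_le.1 hb0.le])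
      have h2 : b ^ L ≤ (σ + 2 * Real.cos θ) ^ L := pow_le_pow_left₀ hb0'.le h L
      have h3 : b ^ L * φ θ ≤ b ^ L * 1 := mul_le_mul_of_nonneg_left h1 (by positivity)
      have : 0 ≤ |σ - 2| ^ L := by positivity
      linarith
    · have h1 : φ θ = 0 := max_eq_left (by linarith)
      rw [h1, mul_zero, zero_sub]
      rcases le_total 0 (σ + 2 * Real.cos θ) with h0 | h0
      · have : 0 ≤ |σ - 2| ^ L := by positivity
        have : 0 ≤ (σ + 2 * Real.cos θ) ^ L := by positivity
        linarith
      · have h2 : |σ + 2 * Real.cos θ| ≤ |σ - 2| := by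
          rw [abs_of_nonpos h0]
          exact le_trans (by linarith) (neg_le_abs _)
        have h3 := pow_le_pow_left₀ (abs_nonneg _) h2 L
        rw [← abs_pow] at h3
        linarith [neg_abs_le ((σ + 2 * Real.cos θ) ^ L)]

/-- Ratio limit for the return weights: the mass of the spectral measure outside any neighbourhood
of `2 + σ` contributes an exponentially smaller amount. Aperiodicity enters through
`|σ - 2| < 2 + σ`, that is `σ > 0`. -/
lemma tendsto_returns_ratio (hσ : 0 < σ) :
    Tendsto (fun L => returns σ (L + 1) / returns σ L) atTop (𝓝 (2 + σ)) := by
  rw [tendsto_ratio_iff (returns_pos hσ)]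
  intro ε₀ hε₀
  have hpi := Real.pi_pos
  -- The bound `ε ≤ 1 + σ` keeps `2 + σ - ε` positive.
  set ε := min (ε₀ / 2) (1 + σ) with hε
  have hε0 : 0 < ε := lt_min (by positivity) (by positivity)
  have hεσ : ε ≤ 1 + σ := min_le_right _ _
  set β := max |σ - 2| (2 + σ - ε) with hβ
  have hβ1 : β < 2 + σ := max_lt (abs_lt.2 ⟨by linarith, by linarith⟩) (by linarith)
  have hβ0 : 0 < β := lt_of_lt_of_le (by linarith) (le_max_right _ _)
  have hsβ : |σ - 2| ≤ β := le_max_left _ _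
  obtain ⟨κ, hκ, hlow⟩ := returns_ge (σ := σ) (b := (β + (2 + σ)) / 2) (by linarith) (by linarith)
  set b := (β + (2 + σ)) / 2 with hb
  have hb0 : 0 < b := by linarith
  -- The error integral is at most `ε` times the main one, up to an exponentially small term.
  have hup : ∀ L, |returns σ (L + 1) - (2 + σ) * returns σ L| ≤
      ε * returns σ L + (4 + ε) * β ^ L := by
    intro L
    have hsin : ∫ θ in (0 : ℝ)..Real.pi, Real.sin θ ^ 2 = Real.pi / 2 := by
      rw [integral_sin_sq]; simp
    have hconst : (4 + ε) * β ^ L = 2 / Real.pi *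
        ∫ θ in (0 : ℝ)..Real.pi, (4 + ε) * β ^ L * Real.sin θ ^ 2 := by
      rw [intervalIntegral.integral_const_mul, hsin]
      field_simp
    rw [returns_eq_integral, returns_eq_integral, hconst, mul_left_comm, mul_left_comm ε, ← mul_sub,
      ← mul_add, abs_mul, abs_of_pos (by positivity : 0 < 2 / Real.pi),
      ← intervalIntegral.integral_const_mul, ← intervalIntegral.integral_const_mul,
      ← intervalIntegral.integral_sub (Continuous.intervalIntegrable (by fun_prop) _ _)
        (Continuous.intervalIntegrable (by fun_prop) _ _),
      ← intervalIntegral.integral_add (Continuous.intervalIntegrable (by fun_prop) _ _)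
        (Continuous.intervalIntegrable (by fun_prop) _ _)]
    refine mul_le_mul_of_nonneg_left ?_ (by positivity)
    refine (intervalIntegral.abs_integral_le_integral_abs hpi.le).trans ?_
    refine intervalIntegral.integral_mono_on hpi.le
      (Continuous.intervalIntegrable (by fun_prop) _ _)
      (Continuous.intervalIntegrable (by fun_prop) _ _) fun θ _ => ?_
    have hc1 := Real.neg_one_le_cos θ
    have hc2 := Real.cos_le_one θ
    set t := σ + 2 * Real.cos θ with ht
    have e1 : t ^ (L + 1) * Real.sin θ ^ 2 - (2 + σ) * (t ^ L * Real.sin θ ^ 2) =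
        (-(2 + σ - t) * t ^ L) * Real.sin θ ^ 2 := by ring
    have e2 : ε * (t ^ L * Real.sin θ ^ 2) + (4 + ε) * β ^ L * Real.sin θ ^ 2 =
        (ε * t ^ L + (4 + ε) * β ^ L) * Real.sin θ ^ 2 := by ring
    rw [e1, e2, abs_mul, abs_of_nonneg (sq_nonneg (Real.sin θ))]
    refine mul_le_mul_of_nonneg_right ?_ (by positivity)
    rw [abs_mul, abs_neg, abs_of_nonneg (by linarith : 0 ≤ 2 + σ - t)]
    have hβL : 0 < β ^ L := by positivity
    rcases le_total (2 + σ - ε) t with h | h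
    · have htL : 0 ≤ t ^ L := pow_nonneg (by linarith) L
      rw [abs_of_nonneg htL]
      have : (2 + σ - t) * t ^ L ≤ ε * t ^ L := mul_le_mul_of_nonneg_right (by linarith) htL
      nlinarith
    · have h1 : |t| ≤ β := by
        rw [abs_le]
        have := neg_abs_le (σ - 2)
        have := le_max_right |σ - 2| (2 + σ - ε)
        constructor <;> linarith
      have h2 : |t ^ L| ≤ β ^ L := by
        rw [abs_pow]; exact pow_le_pow_left₀ (abs_nonneg _) h1 L
      have h3 : (2 + σ - t) * |t ^ L| ≤ 4 * β ^ L :=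
        mul_le_mul (by linarith) h2 (abs_nonneg _) (by norm_num)
      nlinarith [neg_abs_le (t ^ L)]
  have hev : ∀ᶠ L in atTop, (β / b) ^ L < ε * κ / (4 + 2 * ε) :=
    (tendsto_pow_atTop_nhds_zero_of_lt_one (by positivity)
      ((div_lt_one hb0).2 (by linarith))).eventually (gt_mem_nhds (by positivity))
  filter_upwards [hev] with L hL
  rw [div_pow, div_lt_div_iff₀ (by positivity) (by positivity)] at hL
  have h1 := hlow L
  have h2 := hup L
  have h3 : |σ - 2| ^ L ≤ β ^ L := pow_le_pow_left₀ (abs_nonneg _) hsβ L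
  have h4 : ε * (κ * b ^ L - β ^ L) ≤ ε * returns σ L :=
    mul_le_mul_of_nonneg_left (by linarith) hε0.le
  have h5 : 2 * ε * returns σ L ≤ ε₀ * returns σ L :=
    mul_le_mul_of_nonneg_right (by linarith [min_le_left (ε₀ / 2) (1 + σ)]) (returns_pos hσ L).le
  linarith

/-! ### Ratio limits of the partition functions -/

/-- The total weight of the paths of length `L` starting at `n`, with weight `ρ₁ ^ m` for the
end point `m`. -/
noncomputable def endSum (σ ρ₁ : ℝ) (L : ℕ) : ℕ → ℝ := (transfer σ ^ L) (fun n => ρ₁ ^ n)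

/-- The normalizing constant `∑ n, ρ₀ ^ n * endSum σ ρ₁ L n`, as a real number. -/
noncomputable def partition (σ ρ₀ ρ₁ : ℝ) (L : ℕ) : ℝ := ∑' n, ρ₀ ^ n * endSum σ ρ₁ L n

lemma endSum_succ (L : ℕ) : endSum σ ρ₁ (L + 1) = transfer σ (endSum σ ρ₁ L) := by
  rw [endSum, pow_succ']; rfl

lemma zero_pow_eq_single : (fun n => (0 : ℝ) ^ n) = Pi.single 0 1 := by
  ext n
  cases n <;> simp

lemma endSum_zero_right (L : ℕ) : endSum σ 0 L = (transfer σ ^ L) (Pi.single 0 1) := by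
  rw [endSum, zero_pow_eq_single]

lemma endSum_nonneg (hσ : 0 < σ) (hρ₁ : 0 ≤ ρ₁) (L : ℕ) : 0 ≤ endSum σ ρ₁ L :=
  transfer_pow_nonneg hσ (fun n => pow_nonneg hρ₁ n) L

lemma pow_le_endSum_zero (hσ : 0 < σ) (hρ₁ : 0 ≤ ρ₁) (L : ℕ) : σ ^ L ≤ endSum σ ρ₁ L 0 := by
  simpa [endSum] using pow_smul_le_transfer_pow hσ (f := fun n => ρ₁ ^ n)
    (fun n => pow_nonneg hρ₁ n) L 0

lemma endSum_le (hσ : 0 < σ) (hρ : 0 < ρ) (hρ₁ : 0 ≤ ρ₁) (h : ρ₁ ≤ ρ) (L n : ℕ) :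
    endSum σ ρ₁ L n ≤ growth σ ρ ^ L * ρ ^ n :=
  (transfer_pow_mono hσ (g := fun n => ρ ^ n) (fun n => pow_le_pow_left₀ hρ₁ h n) L n).trans
    (transfer_pow_geom_le hσ hρ L n)

lemma hasSum_geom_bound (hρ₀ : 0 < ρ₀) (hρ : 0 < ρ) (h : ρ₀ * ρ < 1) (c : ℝ) :
    HasSum (fun n => ρ₀ ^ n * (c * ρ ^ n)) (c * (1 - ρ₀ * ρ)⁻¹) := by
  refine ((hasSum_geometric_of_lt_one (by positivity) h).mul_left c).congr_fun ?_
  intro n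
  rw [mul_pow]; ring

lemma summable_partition (hσ : 0 < σ) (hρ₀ : 0 < ρ₀) (hρ₀' : ρ₀ < 1) (hρ₁ : 0 ≤ ρ₁)
    (hρ : ρ₀ * ρ₁ < 1) (L : ℕ) : Summable fun n => ρ₀ ^ n * endSum σ ρ₁ L n := by
  have h : ρ₀ * max 1 ρ₁ < 1 := by
    rcases max_choice 1 ρ₁ with h | h <;> rw [h] <;> linarith
  have hpos : 0 < max 1 ρ₁ := by positivity
  refine Summable.of_nonneg_of_le (fun n => ?_) (fun n => ?_)
    (hasSum_geom_bound hρ₀ hpos h (growth σ (max 1 ρ₁) ^ L)).summable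
  · have := endSum_nonneg hσ hρ₁ L n
    simp only [Pi.zero_apply] at this
    positivity
  · exact mul_le_mul_of_nonneg_left (endSum_le hσ hpos hρ₁ (le_max_right _ _) L n) (by positivity)

lemma partition_le (hσ : 0 < σ) (hρ₀ : 0 < ρ₀) (hρ₀' : ρ₀ < 1) (hρ₁ : 0 ≤ ρ₁) (h1 : ρ₁ ≤ 1)
    (L : ℕ) : partition σ ρ₀ ρ₁ L ≤ (2 + σ) ^ L * (1 - ρ₀)⁻¹ := by
  have h := hasSum_geom_bound hρ₀ one_pos (by linarith) (growth σ 1 ^ L)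
  rw [mul_one, growth_one] at h
  refine hasSum_le (fun n => ?_)
    (summable_partition hσ hρ₀ hρ₀' hρ₁ (by nlinarith) L).hasSum h
  have := endSum_le hσ one_pos hρ₁ h1 L n
  rw [growth_one] at this
  exact mul_le_mul_of_nonneg_left this (by positivity)

lemma endSum_zero_le_partition (hσ : 0 < σ) (hρ₀ : 0 < ρ₀) (hρ₀' : ρ₀ < 1) (hρ₁ : 0 ≤ ρ₁)
    (hρ : ρ₀ * ρ₁ < 1) (L : ℕ) : endSum σ ρ₁ L 0 ≤ partition σ ρ₀ ρ₁ L := by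
  have := (summable_partition hσ hρ₀ hρ₀' hρ₁ hρ L).le_tsum 0 fun n _ =>
    mul_nonneg (by positivity) (endSum_nonneg hσ hρ₁ L n)
  simpa [partition] using this

lemma partition_pos (hσ : 0 < σ) (hρ₀ : 0 < ρ₀) (hρ₀' : ρ₀ < 1) (hρ₁ : 0 ≤ ρ₁)
    (hρ : ρ₀ * ρ₁ < 1) (L : ℕ) : 0 < partition σ ρ₀ ρ₁ L :=
  lt_of_lt_of_le (by positivity) ((pow_le_endSum_zero hσ hρ₁ L).trans
    (endSum_zero_le_partition hσ hρ₀ hρ₀' hρ₁ hρ L))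

/-- Summation by parts: `ρ₀ ^ n` is a left eigenvector of the transfer operator except at `0`. -/
lemma tsum_geom_mul_transfer (hρ₀ : ρ₀ ≠ 0) {f : ℕ → ℝ} (hf : Summable fun n => ρ₀ ^ n * f n) :
    ∑' n, ρ₀ ^ n * transfer σ f n = growth σ ρ₀ * ∑' n, ρ₀ ^ n * f n - ρ₀⁻¹ * f 0 := by
  have h1 : HasSum (fun n => ρ₀ ^ n * f (n + 1)) (ρ₀⁻¹ * (∑' n, ρ₀ ^ n * f n - f 0)) := by
    have := ((hasSum_nat_add_iff' 1).2 hf.hasSum).mul_left ρ₀⁻¹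
    simp only [Finset.range_one, Finset.sum_singleton, pow_zero, one_mul] at this
    refine this.congr_fun fun n => ?_
    rw [pow_succ]; field_simp
  have h2 : HasSum (fun n => ρ₀ ^ n * (if n = 0 then 0 else f (n - 1)))
      (ρ₀ * ∑' n, ρ₀ ^ n * f n) := by
    rw [← hasSum_nat_add_iff' 1]
    simp only [Finset.range_one, Finset.sum_singleton, if_true, mul_zero, sub_zero]
    refine (hf.hasSum.mul_left ρ₀).congr_fun fun n => ?_
    simp [pow_succ]; ring
  have h3 := ((h1.add (hf.hasSum.mul_left σ)).add h2).tsum_eq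
  rw [← sub_eq_zero]
  rw [← sub_eq_zero] at h3
  refine Eq.trans ?_ h3
  have e : (fun n => ρ₀ ^ n * transfer σ f n) = fun n => ρ₀ ^ n * f (n + 1) +
      σ * (ρ₀ ^ n * f n) + ρ₀ ^ n * (if n = 0 then 0 else f (n - 1)) := by
    ext n
    simp only [transfer, LinearMap.coe_mk, AddHom.coe_mk]
    ring
  rw [e]
  simp only [growth]
  field_simp
  ring

/-- Removing the first step of the path. -/
lemma partition_succ_left (hσ : 0 < σ) (hρ₀ : 0 < ρ₀) (hρ₀' : ρ₀ < 1) (hρ₁ : 0 ≤ ρ₁)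
    (hρ : ρ₀ * ρ₁ < 1) (L : ℕ) :
    partition σ ρ₀ ρ₁ (L + 1) =
      growth σ ρ₀ * partition σ ρ₀ ρ₁ L - ρ₀⁻¹ * endSum σ ρ₁ L 0 := by
  rw [partition, endSum_succ, tsum_geom_mul_transfer hρ₀.ne'
    (summable_partition hσ hρ₀ hρ₀' hρ₁ hρ L), partition]

/-- Removing the last step of the path. -/
lemma partition_succ_right (hσ : 0 < σ) (hρ₀ : 0 < ρ₀) (hρ₀' : ρ₀ < 1) (hρ₁ : 0 < ρ₁)
    (hρ : ρ₀ * ρ₁ < 1) (L : ℕ) :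
    partition σ ρ₀ ρ₁ (L + 1) =
      growth σ ρ₁ * partition σ ρ₀ ρ₁ L - ρ₁⁻¹ * partition σ ρ₀ 0 L := by
  have h1 := (summable_partition hσ hρ₀ hρ₀' hρ₁.le hρ L).hasSum.mul_left (growth σ ρ₁)
  have h2 := (summable_partition hσ hρ₀ hρ₀' le_rfl (by simp) L).hasSum.mul_left ρ₁⁻¹
  rw [partition, partition, partition, ← (h1.sub h2).tsum_eq]
  congr 1
  ext n
  rw [endSum, transfer_pow_succ_geom hρ₁.ne', endSum_zero_right]
  simp only [Pi.sub_apply, Pi.smul_apply, smul_eq_mul, endSum]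
  ring

lemma tendsto_partition_div_pow_of_lt (hσ : 0 < σ) (hρ₀ : 0 < ρ₀) (hρ₀' : ρ₀ < 1) (hρ₁ : 0 ≤ ρ₁)
    (h1 : ρ₁ ≤ 1) {μ : ℝ} (hμ : 2 + σ < μ) :
    Tendsto (fun L => partition σ ρ₀ ρ₁ L / μ ^ L) atTop (𝓝 0) := by
  have hμ0 : 0 < μ := by linarith
  have h := (tendsto_pow_atTop_nhds_zero_of_lt_one (by positivity : 0 ≤ (2 + σ) / μ)
    ((div_lt_one hμ0).2 hμ)).mul_const (1 - ρ₀)⁻¹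
  rw [zero_mul] at h
  refine squeeze_zero (fun L => ?_) (fun L => ?_) h
  · exact div_nonneg (partition_pos hσ hρ₀ hρ₀' hρ₁ (by nlinarith) L).le (by positivity)
  · rw [div_pow, div_mul_eq_mul_div]
    exact div_le_div_of_nonneg_right (partition_le hσ hρ₀ hρ₀' hρ₁ h1 L) (by positivity)

lemma tendsto_partition_zero_ratio (hσ : 0 < σ) (hρ₀ : 0 < ρ₀) (hρ₀' : ρ₀ < 1) :
    Tendsto (fun L => partition σ ρ₀ 0 (L + 1) / partition σ ρ₀ 0 L) atTop (𝓝 (2 + σ)) := by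
  have h0 : ρ₀ * 0 < 1 := by simp
  refine tendsto_ratio_of_recurrence (y := returns σ) (growth_pos hσ hρ₀) (inv_nonneg.2 hρ₀.le)
    (partition_pos hσ hρ₀ hρ₀' le_rfl h0) (returns_pos hσ) (fun L => ?_)
    (tendsto_partition_div_pow_of_lt hσ hρ₀ hρ₀' le_rfl zero_le_one
      (two_add_lt_growth hρ₀ hρ₀'.ne)) (tendsto_returns_ratio hσ)
  rw [partition_succ_left hσ hρ₀ hρ₀' le_rfl h0, endSum_zero_right, returns]

/-- The growth rate of the normalizing constants. For `ρ₁ ≤ 1` it is the upper end point `2 + σ` of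
the spectrum; for `ρ₁ > 1` the boundary weight creates a larger eigenvalue. -/
lemma tendsto_partition_ratio (hσ : 0 < σ) (hρ₀ : 0 < ρ₀) (hρ₀' : ρ₀ < 1) (hρ₁ : 0 ≤ ρ₁)
    (hρ : ρ₀ * ρ₁ < 1) :
    Tendsto (fun L => partition σ ρ₀ ρ₁ (L + 1) / partition σ ρ₀ ρ₁ L) atTop
      (𝓝 (growth σ (max 1 ρ₁))) := by
  rcases hρ₁.eq_or_lt with rfl | hpos
  · rw [max_eq_left zero_le_one, growth_one]
    exact tendsto_partition_zero_ratio hσ hρ₀ hρ₀'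
  have hC := partition_pos hσ hρ₀ hρ₀' hρ₁ hρ
  have hN := partition_pos (ρ₁ := 0) hσ hρ₀ hρ₀' le_rfl (by simp)
  have hrec := partition_succ_right hσ hρ₀ hρ₀' hpos hρ
  have hgrow := growth_pos hσ hpos
  have hle : ∀ L, partition σ ρ₀ ρ₁ (L + 1) ≤ growth σ ρ₁ * partition σ ρ₀ ρ₁ L := fun L => by
    have := mul_pos (inv_pos.2 hpos) (hN L)
    rw [hrec]; linarith
  have hsub : Tendsto (fun L => partition σ ρ₀ ρ₁ L / growth σ ρ₁ ^ L) atTop (𝓝 0) →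
      Tendsto (fun L => partition σ ρ₀ ρ₁ (L + 1) / partition σ ρ₀ ρ₁ L) atTop (𝓝 (2 + σ)) :=
    fun h => tendsto_ratio_of_recurrence hgrow (inv_nonneg.2 hρ₁) hC hN hrec h
      (tendsto_partition_zero_ratio hσ hρ₀ hρ₀')
  rcases lt_trichotomy ρ₁ 1 with h1 | rfl | h1
  · rw [max_eq_left h1.le, growth_one]
    exact hsub (tendsto_partition_div_pow_of_lt hσ hρ₀ hρ₀' hρ₁ h1.le
      (two_add_lt_growth hpos h1.ne))
  · -- Both possible behaviours of `partition / (2 + σ) ^ L` lead to the same ratio limit.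
    rw [max_self]
    obtain ⟨l, hl, hlim⟩ := exists_tendsto_div_pow (b := 0) hgrow
      (fun L => by rw [zero_mul]; exact (hC L).le) hle
    rcases eq_or_ne l 0 with rfl | hl0
    · rw [growth_one]
      exact hsub hlim
    · exact tendsto_ratio_of_tendsto_div_pow hgrow hl0 hlim
  · rw [max_eq_right h1.le]
    have hb : 0 < 1 - 1 / ρ₁ ^ 2 := by
      rw [sub_pos, div_lt_one (by positivity)]
      nlinarith
    obtain ⟨l, hl, hlim⟩ := exists_tendsto_div_pow (b := 1 - 1 / ρ₁ ^ 2) hgrow (fun L => by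
      refine le_trans ?_ (endSum_zero_le_partition hσ hρ₀ hρ₀' hρ₁ hρ L)
      have := transfer_pow_mono hσ (f := (1 - 1 / ρ₁ ^ 2) • harmonic ρ₁)
        (g := fun n => ρ₁ ^ n) (fun n => harmonic_le h1 n) L 0
      rw [map_smul, transfer_pow_harmonic hpos.ne'] at this
      simpa [harmonic_zero, endSum] using this) hle
    exact tendsto_ratio_of_tendsto_div_pow hgrow (by linarith) hlim

/-- The right-hand side is the normalization of the initial law `ρ₀ ^ n * harmonic ρ n`. -/
lemma mul_growth_sub (hρ₀ : ρ₀ ≠ 0) (hρ : ρ ≠ 0) :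
    ρ₀ * (growth σ ρ₀ - growth σ ρ) = (1 - ρ₀ * ρ) * (1 - ρ₀ / ρ) := by
  unfold growth
  field_simp
  ring

/-- The weights of paths started at `n`, relative to the normalizing constant, converge to a
multiple of the harmonic function. -/
lemma tendsto_endSum_div_partition (hσ : 0 < σ) (hρ₀ : 0 < ρ₀) (hρ₀' : ρ₀ < 1) (hρ₁ : 0 ≤ ρ₁)
    (hρ : ρ₀ * ρ₁ < 1) (n : ℕ) :
    Tendsto (fun L => endSum σ ρ₁ L n / partition σ ρ₀ ρ₁ L) atTop
      (𝓝 ((1 - ρ₀ * max 1 ρ₁) * (1 - ρ₀ / max 1 ρ₁) * harmonic (max 1 ρ₁) n)) := by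
  have hm : max 1 ρ₁ ≠ 0 := by positivity
  have hC := partition_pos hσ hρ₀ hρ₀' hρ₁ hρ
  have hr := tendsto_partition_ratio hσ hρ₀ hρ₀' hρ₁ hρ
  generalize max 1 ρ₁ = r at *
  set K := (1 - ρ₀ * r) * (1 - ρ₀ / r) with hK
  -- The value at `n` after one more step determines the value at `n + 1`.
  have hshift : ∀ n, Tendsto (fun L => endSum σ ρ₁ L n / partition σ ρ₀ ρ₁ L) atTop
      (𝓝 (K * harmonic r n)) →
      Tendsto (fun L => endSum σ ρ₁ (L + 1) n / partition σ ρ₀ ρ₁ L) atTop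
        (𝓝 (K * harmonic r n * growth σ r)) := fun n hn =>
    (((tendsto_add_atTop_iff_nat 1).2 hn).mul hr).congr fun L => by
      have := (hC L).ne'
      have := (hC (L + 1)).ne'
      field_simp
  have h0 : Tendsto (fun L => endSum σ ρ₁ L 0 / partition σ ρ₀ ρ₁ L) atTop
      (𝓝 (K * harmonic r 0)) := by
    rw [harmonic_zero, mul_one, hK, ← mul_growth_sub (σ := σ) hρ₀.ne' hm]
    refine ((hr.const_sub (growth σ ρ₀)).const_mul ρ₀).congr fun L => ?_
    have := (hC L).ne'
    rw [partition_succ_left hσ hρ₀ hρ₀' hρ₁ hρ]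
    field_simp
    ring
  have h1 : Tendsto (fun L => endSum σ ρ₁ L 1 / partition σ ρ₀ ρ₁ L) atTop
      (𝓝 (K * harmonic r 1)) := by
    have e : K * harmonic r 1 = K * harmonic r 0 * growth σ r - σ * (K * harmonic r 0) := by
      rw [harmonic_succ, harmonic_zero, growth]; ring
    rw [e]
    refine ((hshift 0 h0).sub (h0.const_mul σ)).congr fun L => ?_
    rw [endSum_succ, transfer_apply_zero]
    ring
  refine Nat.twoStepInduction h0 h1 (fun n hn hn1 => ?_) n
  have e : K * harmonic r (n + 2) = K * harmonic r (n + 1) * growth σ r -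
      σ * (K * harmonic r (n + 1)) - K * harmonic r n := by
    rw [harmonic_add_two hm, growth]; ring
  rw [e]
  refine (((hshift _ hn1).sub (hn1.const_mul σ)).sub hn).congr fun L => ?_
  rw [endSum_succ, transfer_apply_succ]
  ring

lemma tendsto_endSum_div_partition_add (hσ : 0 < σ) (hρ₀ : 0 < ρ₀) (hρ₀' : ρ₀ < 1) (hρ₁ : 0 ≤ ρ₁)
    (hρ : ρ₀ * ρ₁ < 1) (n k : ℕ) :
    Tendsto (fun L => endSum σ ρ₁ L n / partition σ ρ₀ ρ₁ (L + k)) atTop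
      (𝓝 ((1 - ρ₀ * max 1 ρ₁) * (1 - ρ₀ / max 1 ρ₁) * harmonic (max 1 ρ₁) n /
        growth σ (max 1 ρ₁) ^ k)) := by
  have hC := partition_pos hσ hρ₀ hρ₀' hρ₁ hρ
  induction k with
  | zero => simpa using tendsto_endSum_div_partition hσ hρ₀ hρ₀' hρ₁ hρ n
  | succ k ih =>
    have hr := (tendsto_add_atTop_iff_nat k).2 (tendsto_partition_ratio hσ hρ₀ hρ₀' hρ₁ hρ)
    rw [pow_succ, ← div_div]
    refine (ih.div hr (growth_pos hσ (by positivity)).ne').congr fun L => ?_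
    have := (hC (L + k)).ne'
    have := (hC (L + k + 1)).ne'
    simp only [Pi.div_apply, ← add_assoc]
    field_simp

/-! ### Sums over paths -/

/-- The matrix of the transfer operator: the edge weight from `n` to `m`, set to `0` when
`|m - n| > 1`. -/
noncomputable def adj (σ : ℝ) (n m : ℕ) : ℝ :=
  if m ≤ n + 1 ∧ n ≤ m + 1 then edgeWeight (fun _ => 1) (fun _ => σ) (fun _ => 1) n m else 0

lemma adj_nonneg (hσ : 0 < σ) (n m : ℕ) : 0 ≤ adj σ n m := by
  unfold adj edgeWeight
  split_ifs <;> positivity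

lemma hasSum_adj (f : ℕ → ℝ) (n : ℕ) :
    HasSum (fun m => adj σ n m * f m) (transfer σ f n) := by
  cases n with
  | zero =>
    have h := hasSum_sum_of_ne_finset_zero (f := fun m => adj σ 0 m * f m) (s := {1, 0})
      (L := SummationFilter.unconditional ℕ) fun m hm => by
        simp only [Finset.mem_insert, Finset.mem_singleton] at hm
        rw [adj, if_neg (by omega), zero_mul]
    simpa [adj, edgeWeight, transfer_apply_zero] using h
  | succ n =>
    have h := hasSum_sum_of_ne_finset_zero (f := fun m => adj σ (n + 1) m * f m)
      (s := {n + 2, n + 1, n}) (L := SummationFilter.unconditional ℕ) fun m hm => by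
        simp only [Finset.mem_insert, Finset.mem_singleton] at hm
        rw [adj, if_neg (by omega), zero_mul]
    rw [Finset.sum_insert (by simp), Finset.sum_insert (by simp), Finset.sum_singleton] at h
    simpa [adj, edgeWeight, transfer_apply_succ, add_assoc] using h

lemma tsum_ofReal_adj (hσ : 0 < σ) {f : ℕ → ℝ} (hf : 0 ≤ f) (n : ℕ) :
    ∑' m, ENNReal.ofReal (adj σ n m) * ENNReal.ofReal (f m) = ENNReal.ofReal (transfer σ f n) := by
  rw [← (hasSum_adj f n).tsum_eq, ENNReal.ofReal_tsum_of_nonneg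
    (fun m => mul_nonneg (adj_nonneg hσ n m) (hf m)) (hasSum_adj f n).summable]
  exact tsum_congr fun m => (ENNReal.ofReal_mul (adj_nonneg hσ n m)).symm

/-- The weight of the edges and of the right end point of an arbitrary sequence of altitudes; it
vanishes unless the sequence is a Motzkin path. -/
noncomputable def chainWeight (σ ρ₁ : ℝ) {L : ℕ} (γ : Fin (L + 1) → ℕ) : ℝ≥0∞ :=
  (∏ j : Fin L, ENNReal.ofReal (adj σ (γ j.castSucc) (γ j.succ))) *
    ENNReal.ofReal (ρ₁ ^ γ (Fin.last L))

lemma chainWeight_cons {L : ℕ} (n : ℕ) (γ : Fin (L + 1) → ℕ) :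
    chainWeight σ ρ₁ (L := L + 1) (Fin.cons n γ : Fin (L + 2) → ℕ) =
      ENNReal.ofReal (adj σ n (γ 0)) * chainWeight σ ρ₁ γ := by
  rw [chainWeight, Fin.prod_univ_succ, chainWeight, mul_assoc]
  congr 1

lemma tsum_fin_succ {L : ℕ} (F : (Fin (L + 2) → ℕ) → ℝ≥0∞) :
    ∑' γ, F γ = ∑' (n : ℕ) (γ : Fin (L + 1) → ℕ), F (Fin.cons n γ : Fin (L + 2) → ℕ) := by
  rw [← (Fin.consEquiv (fun _ : Fin (L + 2) => ℕ)).tsum_eq, ENNReal.tsum_prod']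
  rfl

lemma tsum_chainWeight (hσ : 0 < σ) (hρ₁ : 0 ≤ ρ₁) (L : ℕ) (u : ℕ → ℝ≥0∞) :
    ∑' γ : Fin (L + 1) → ℕ, u (γ 0) * chainWeight σ ρ₁ γ =
      ∑' n, u n * ENNReal.ofReal (endSum σ ρ₁ L n) := by
  induction L generalizing u with
  | zero =>
    rw [← (Equiv.funUnique (Fin 1) ℕ).symm.tsum_eq]
    refine tsum_congr fun n => ?_
    simp [chainWeight, endSum]
  | succ L ih =>
    rw [tsum_fin_succ]
    refine tsum_congr fun n => ?_
    simp only [chainWeight_cons, Fin.cons_zero, ENNReal.tsum_mul_left]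
    rw [ih fun m => ENNReal.ofReal (adj σ n m), tsum_ofReal_adj hσ (endSum_nonneg hσ hρ₁ L),
      endSum_succ]

/-- The total weight of the sequences of altitudes with prescribed first `k + 1` terms. -/
lemma tsum_chainWeight_cylinder (hσ : 0 < σ) (hρ₁ : 0 ≤ ρ₁) (l k : ℕ) (u : ℕ → ℝ≥0∞)
    (x : ℕ → ℕ) :
    ∑' γ : Fin (l + k + 1) → ℕ,
        (if ∀ i : Fin (l + k + 1), (i : ℕ) ≤ k → γ i = x i then u (γ 0) * chainWeight σ ρ₁ γ
          else 0) =
      u (x 0) * (∏ i ∈ Finset.range k, ENNReal.ofReal (adj σ (x i) (x (i + 1)))) *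
        ENNReal.ofReal (endSum σ ρ₁ l (x k)) := by
  induction k generalizing u x with
  | zero =>
    have h := tsum_chainWeight hσ hρ₁ l fun n => if n = x 0 then u n else 0
    simp only [ite_mul, zero_mul, tsum_ite_eq] at h
    rw [Finset.prod_range_zero, mul_one, ← h]
    refine tsum_congr fun γ => ?_
    congr 1
    refine propext ⟨fun H => H 0 le_rfl, fun H i hi => ?_⟩
    have : i = 0 := Fin.ext (by simpa using hi)
    rw [this]
    exact H
  | succ k ih =>
    have h := ih (fun m => ENNReal.ofReal (adj σ (x 0) m)) fun i => x (i + 1)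
    rw [Finset.prod_range_succ', zero_add, mul_comm (∏ i ∈ _, _), ← mul_assoc, mul_assoc,
      mul_assoc, ← mul_assoc (ENNReal.ofReal _), ← h, ← ENNReal.tsum_mul_left]
    refine (tsum_fin_succ _).trans ?_
    rw [tsum_eq_single (x 0)]
    · refine tsum_congr fun γ => ?_
      rw [mul_ite, mul_zero, chainWeight_cons, Fin.cons_zero]
      congr 1
      refine propext ⟨fun H i hi => ?_, fun H i => ?_⟩
      · have := H i.succ (by simpa using hi)
        simpa using this
      · refine Fin.cases (fun _ => rfl) (fun j hj => ?_) i
        have := H j (by simpa using hj)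
        simpa using this
    · intro n hn
      refine ENNReal.tsum_eq_zero.2 fun γ => if_neg fun H => hn ?_
      exact H 0 (Nat.zero_le _)

lemma totalWeight_eq (hσ : 0 < σ) (hρ₀ : 0 < ρ₀) {L : ℕ} (γ : MotzkinPath L) :
    totalWeight (fun _ => 1) (fun _ => σ) (fun _ => 1) (fun n => ρ₀ ^ n) (fun n => ρ₁ ^ n) L γ =
      ENNReal.ofReal (ρ₀ ^ γ.1 0) * chainWeight σ ρ₁ γ.1 := by
  have h : pathWeight (fun _ => 1) (fun _ => σ) (fun _ => 1) γ =
      ∏ j : Fin L, adj σ (γ.1 j.castSucc) (γ.1 j.succ) :=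
    Finset.prod_congr rfl fun j _ => (if_pos (γ.2 j)).symm
  have h0 : 0 ≤ ∏ j : Fin L, adj σ (γ.1 j.castSucc) (γ.1 j.succ) :=
    Finset.prod_nonneg fun j _ => adj_nonneg hσ _ _
  rw [totalWeight, h, ENNReal.ofReal_mul (by positivity), ENNReal.ofReal_mul (by positivity),
    ENNReal.ofReal_prod_of_nonneg fun j _ => adj_nonneg hσ _ _, mul_assoc, chainWeight]

/-- A sum over Motzkin paths is a sum over all sequences of altitudes, as `chainWeight` vanishes on
the other ones. -/
lemma tsum_motzkinPath {L : ℕ} (F : (Fin (L + 1) → ℕ) → ℝ≥0∞)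
    (hF : ∀ γ, chainWeight σ ρ₁ γ = 0 → F γ = 0) :
    ∑' γ : MotzkinPath L, F γ.1 = ∑' γ, F γ := by
  refine Function.Injective.tsum_eq (g := fun γ : MotzkinPath L => γ.1) (f := F)
    Subtype.val_injective fun γ hγ => ?_
  by_contra hn
  have hn' : ¬ ∀ j : Fin L, γ j.succ ≤ γ j.castSucc + 1 ∧ γ j.castSucc ≤ γ j.succ + 1 :=
    fun H => hn ⟨⟨γ, H⟩, rfl⟩
  obtain ⟨j, hj⟩ := not_forall.1 hn'
  refine hγ (hF γ ?_)
  rw [chainWeight, Finset.prod_eq_zero (Finset.mem_univ j), zero_mul]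
  rw [adj, if_neg hj, ENNReal.ofReal_zero]

lemma normConst_eq (hσ : 0 < σ) (hρ₀ : 0 < ρ₀) (hρ₀' : ρ₀ < 1) (hρ₁ : 0 ≤ ρ₁)
    (hρ : ρ₀ * ρ₁ < 1) (L : ℕ) :
    normConst (fun _ => 1) (fun _ => σ) (fun _ => 1) (fun n => ρ₀ ^ n) (fun n => ρ₁ ^ n) L =
      ENNReal.ofReal (partition σ ρ₀ ρ₁ L) := by
  simp only [normConst, totalWeight_eq hσ hρ₀]
  rw [tsum_motzkinPath (σ := σ) (ρ₁ := ρ₁)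
      (fun γ => ENNReal.ofReal (ρ₀ ^ γ 0) * chainWeight σ ρ₁ γ) (fun γ h => by simp [h]),
    tsum_chainWeight hσ hρ₁ L fun n => ENNReal.ofReal (ρ₀ ^ n), partition,
    ENNReal.ofReal_tsum_of_nonneg
      (fun n => mul_nonneg (by positivity) (endSum_nonneg hσ hρ₁ L n))
      (summable_partition hσ hρ₀ hρ₀' hρ₁ hρ L)]
  exact tsum_congr fun n => (ENNReal.ofReal_mul (by positivity)).symm

/-- The set of sequences with prescribed values at the times `0, …, k`. -/
def cylinder (k : ℕ) (x : ℕ → ℕ) : Set (ℕ → ℕ) := {z | ∀ i ≤ k, z i = x i}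

lemma measurableSet_cylinder (k : ℕ) (x : ℕ → ℕ) : MeasurableSet (cylinder k x) := by
  have : cylinder k x = ⋂ i ≤ k, {z : ℕ → ℕ | z i = x i} := by ext; simp [cylinder]
  rw [this]
  exact MeasurableSet.iInter fun i => MeasurableSet.iInter fun _ =>
    (measurable_pi_apply (X := fun _ : ℕ => ℕ) i) (measurableSet_singleton (x i))

/-- The finite-dimensional distributions of the left boundary process. -/
lemma leftBoundaryLaw_cylinder (hσ : 0 < σ) (hρ₀ : 0 < ρ₀) (hρ₀' : ρ₀ < 1) (hρ₁ : 0 ≤ ρ₁)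
    (hρ : ρ₀ * ρ₁ < 1) (l k : ℕ)
    (h : normConst (fun _ => 1) (fun _ => σ) (fun _ => 1) (fun n => ρ₀ ^ n) (fun n => ρ₁ ^ n)
        (l + k) ≠ 0 ∧
      normConst (fun _ => 1) (fun _ => σ) (fun _ => 1) (fun n => ρ₀ ^ n) (fun n => ρ₁ ^ n)
        (l + k) ≠ ∞) (x : ℕ → ℕ) :
    (leftBoundaryLaw (fun _ => 1) (fun _ => σ) (fun _ => 1) (fun n => ρ₀ ^ n) (fun n => ρ₁ ^ n)
        (l + k) h : Measure (ℕ → ℕ)) (cylinder k x) =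
      ENNReal.ofReal (ρ₀ ^ x 0 * (∏ i ∈ Finset.range k, adj σ (x i) (x (i + 1))) *
        (endSum σ ρ₁ l (x k) / partition σ ρ₀ ρ₁ (l + k))) := by
  have h1 : ∀ γ : MotzkinPath (l + k), γ ∈ extend ⁻¹' cylinder k x ↔
      ∀ i : Fin (l + k + 1), (i : ℕ) ≤ k → γ.1 i = x i := by
    intro γ
    constructor
    · intro H i hi
      have := H i hi
      rwa [extend, dif_pos i.2] at this
    · intro H i hi
      rw [extend, dif_pos (by omega)]
      exact H ⟨i, by omega⟩ hi
  have h0 : 0 ≤ ∏ i ∈ Finset.range k, adj σ (x i) (x (i + 1)) :=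
    Finset.prod_nonneg fun j _ => adj_nonneg hσ _ _
  have hC := partition_pos hσ hρ₀ hρ₀' hρ₁ hρ (l + k)
  change ((pathPMF _ _ _ _ _ (l + k) h).map extend).toMeasure (cylinder k x) = _
  rw [PMF.toMeasure_apply_eq_toOuterMeasure_apply _ (measurableSet_cylinder k x),
    PMF.toOuterMeasure_map_apply, PMF.toOuterMeasure_apply]
  have h2 : ∀ γ : MotzkinPath (l + k),
      (extend ⁻¹' cylinder k x).indicator
        (pathPMF (fun _ => 1) (fun _ => σ) (fun _ => 1) (fun n => ρ₀ ^ n) (fun n => ρ₁ ^ n)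
          (l + k) h) γ =
      (if ∀ i : Fin (l + k + 1), (i : ℕ) ≤ k → γ.1 i = x i then
        ENNReal.ofReal (ρ₀ ^ γ.1 0) * chainWeight σ ρ₁ γ.1 else 0) *
          (ENNReal.ofReal (partition σ ρ₀ ρ₁ (l + k)))⁻¹ := by
    intro γ
    by_cases hγ : γ ∈ extend ⁻¹' cylinder k x
    swap
    · rw [Set.indicator_of_notMem hγ, if_neg fun H => hγ ((h1 γ).2 H), zero_mul]
    rw [Set.indicator_of_mem hγ, if_pos ((h1 γ).1 hγ), ← totalWeight_eq hσ hρ₀,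
      ← normConst_eq hσ hρ₀ hρ₀' hρ₁ hρ (l + k)]
    exact PMF.normalize_apply h.1 h.2 γ
  rw [tsum_congr h2, ENNReal.tsum_mul_right, tsum_motzkinPath (σ := σ) (ρ₁ := ρ₁)
      (fun γ => if ∀ i : Fin (l + k + 1), (i : ℕ) ≤ k → γ i = x i then
        ENNReal.ofReal (ρ₀ ^ γ 0) * chainWeight σ ρ₁ γ else 0) (fun γ hγ => by simp [hγ]),
    tsum_chainWeight_cylinder hσ hρ₁ l k fun n => ENNReal.ofReal (ρ₀ ^ n),
    ← ENNReal.ofReal_prod_of_nonneg fun j _ => adj_nonneg hσ _ _,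
    ← ENNReal.ofReal_mul (by positivity), ← ENNReal.ofReal_mul (by positivity),
    ← ENNReal.ofReal_inv_of_pos hC, ← ENNReal.ofReal_mul
      (mul_nonneg (by positivity) (endSum_nonneg hσ hρ₁ l (x k))), mul_assoc, div_eq_mul_inv]

/-! ### Existence of Markov chains and convergence on cylinders -/

/-- The kernel giving the next state of the chain as a function of its past up to time `n`. -/
noncomputable def stepKernel (Q : ℕ → ℕ → ℝ) (n : ℕ) :
    Kernel ((i : Finset.Iic n) → (fun _ : ℕ => ℕ) i) ℕ :=
  Kernel.ofFunOfCountable fun x =>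
    Measure.sum fun m : ℕ => ENNReal.ofReal (Q (x ⟨n, by simp⟩) m) • Measure.dirac m

lemma sum_smul_dirac_singleton (w : ℕ → ℝ≥0∞) (n : ℕ) :
    (Measure.sum fun m : ℕ => w m • Measure.dirac m) {n} = w n := by
  rw [Measure.sum_apply _ (measurableSet_singleton n), tsum_eq_single n]
  · simp
  · intro m hm
    simp [hm]

lemma isProbabilityMeasure_sum_smul_dirac {w : ℕ → ℝ} (hw : ∀ n, 0 ≤ w n) (h : HasSum w 1) :
    IsProbabilityMeasure (Measure.sum fun m : ℕ => ENNReal.ofReal (w m) • Measure.dirac m) := by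
  constructor
  rw [Measure.sum_apply _ MeasurableSet.univ]
  simp [← ENNReal.ofReal_tsum_of_nonneg hw h.summable, h.tsum_eq]

lemma isMarkovKernel_stepKernel {Q : ℕ → ℕ → ℝ} (hQ : ∀ n m, 0 ≤ Q n m)
    (hQ1 : ∀ n, HasSum (Q n) 1) (n : ℕ) : IsMarkovKernel (stepKernel Q n) :=
  ⟨fun x => isProbabilityMeasure_sum_smul_dirac (hQ (x ⟨n, by simp⟩)) (hQ1 _)⟩

/-- Every stochastic matrix on `ℕ` and every initial law are those of a Markov chain, realized as
the coordinate process by the Ionescu-Tulcea theorem. -/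
theorem exists_isMarkovChain {Q : ℕ → ℕ → ℝ} (hQ : ∀ n m, 0 ≤ Q n m)
    (hQ1 : ∀ n, HasSum (Q n) 1) (μ₀ : Measure ℕ) [IsProbabilityMeasure μ₀] :
    ∃ μ : ProbabilityMeasure (ℕ → ℕ),
      IsMarkovChain (μ : Measure (ℕ → ℕ)) (fun k z => z k) Q ∧
        (μ : Measure (ℕ → ℕ)).map (fun z => z 0) = μ₀ := by
  have := isMarkovKernel_stepKernel hQ hQ1
  let μ := Kernel.trajMeasure (X := fun _ => ℕ) μ₀ (stepKernel Q)
  have hμ : IsProbabilityMeasure μ := inferInstance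
  refine ⟨⟨μ, hμ⟩, ⟨fun k => measurable_pi_apply k, hQ, hQ1, fun k x => ?_⟩, ?_⟩
  · change μ (cylinder (k + 1) x) = μ (cylinder k x) * _
    have h := Kernel.map_frestrictLe_trajMeasure_compProd_eq_map_trajMeasure
      (X := fun _ => ℕ) (μ₀ := μ₀) (κ := stepKernel Q) (a := k)
    have h2 := congrArg (fun ν => ν ({Preorder.frestrictLe k x} ×ˢ {x (k + 1)})) h
    have hms := (measurableSet_singleton (Preorder.frestrictLe (π := fun _ : ℕ => ℕ) k x)).prod
      (measurableSet_singleton (x (k + 1)))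
    have hm1 : Measurable (Preorder.frestrictLe (π := fun _ : ℕ => ℕ) k) := by fun_prop
    have hm2 : Measurable fun z : ℕ → ℕ => (Preorder.frestrictLe (π := fun _ : ℕ => ℕ) k z,
      z (k + 1)) := by fun_prop
    have e : ∀ z : ℕ → ℕ, Preorder.frestrictLe (π := fun _ : ℕ => ℕ) k z =
        Preorder.frestrictLe (π := fun _ : ℕ => ℕ) k x ↔ z ∈ cylinder k x := by
      intro z
      constructor
      · intro H i hi
        exact congrFun H ⟨i, Finset.mem_Iic.2 hi⟩
      · intro H
        ext i
        exact H i (Finset.mem_Iic.1 i.2)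
    rw [Measure.compProd_apply_prod (measurableSet_singleton _) (measurableSet_singleton _),
      lintegral_singleton, Measure.map_apply hm1 (measurableSet_singleton _),
      Measure.map_apply hm2 hms] at h2
    -- Both sides of `h2` are evaluated on the rectangle whose preimage is a cylinder.
    have e1 : Preorder.frestrictLe (π := fun _ : ℕ => ℕ) k ⁻¹'
        {Preorder.frestrictLe (π := fun _ : ℕ => ℕ) k x} = cylinder k x := by
      ext z; exact e z
    have e2 : (fun z : ℕ → ℕ => (Preorder.frestrictLe (π := fun _ : ℕ => ℕ) k z, z (k + 1))) ⁻¹'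
        ({Preorder.frestrictLe (π := fun _ : ℕ => ℕ) k x} ×ˢ {x (k + 1)}) =
          cylinder (k + 1) x := by
      ext z
      refine (and_congr_left' (e z)).trans ⟨fun H i hi => ?_, fun H => ⟨fun i hi => ?_, ?_⟩⟩
      · rcases Nat.le_succ_iff.1 hi with hi | rfl
        · exact H.1 i hi
        · exact H.2
      · exact H i (by omega)
      · exact H (k + 1) le_rfl
    have e3 : stepKernel Q k (Preorder.frestrictLe (π := fun _ : ℕ => ℕ) k x) {x (k + 1)} =
        ENNReal.ofReal (Q (x k) (x (k + 1))) := sum_smul_dirac_singleton _ _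
    rw [e1, e2, e3] at h2
    rw [mul_comm]
    exact h2.symm
  · change μ.map _ = _
    have h : μ.map (Preorder.frestrictLe (π := fun _ : ℕ => ℕ) 0) =
        μ₀.map (MeasurableEquiv.piUnique fun _ : Finset.Iic 0 => ℕ).symm := by
      simp only [μ, Kernel.trajMeasure]
      rw [Measure.map_comp _ _ (by fun_prop), Kernel.traj_map_frestrictLe,
        Kernel.partialTraj_self, Measure.id_comp]
    have h2 := congrArg (Measure.map fun y => y ⟨0, by simp⟩) h
    rw [Measure.map_map (by fun_prop) (by fun_prop),
      Measure.map_map (by fun_prop) (by fun_prop)] at h2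
    refine h2.trans (Eq.trans ?_ Measure.map_id)
    rfl

lemma IsMarkovChain.cylinder_eq {Q : ℕ → ℕ → ℝ} {μ : Measure (ℕ → ℕ)}
    (h : IsMarkovChain μ (fun k z => z k) Q) (k : ℕ) (x : ℕ → ℕ) :
    μ (cylinder k x) = μ.map (fun z => z 0) {x 0} *
      ENNReal.ofReal (∏ i ∈ Finset.range k, Q (x i) (x (i + 1))) := by
  induction k with
  | zero =>
    rw [Measure.map_apply (h.measurable 0) (measurableSet_singleton _), Finset.prod_range_zero,
      ENNReal.ofReal_one, mul_one]
    congr 1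
    ext z
    simp [cylinder]
  | succ k ih =>
    rw [Finset.prod_range_succ, ENNReal.ofReal_mul (Finset.prod_nonneg fun i _ => h.nonneg _ _),
      ← mul_assoc, ← ih]
    exact h.step k x

lemma cylinder_eq_of_mem {k : ℕ} {x z : ℕ → ℕ} (hz : z ∈ cylinder k x) :
    cylinder k x = cylinder k z := by
  ext y
  exact ⟨fun hy i hi => (hy i hi).trans (hz i hi).symm, fun hy i hi => (hy i hi).trans (hz i hi)⟩

/-- Weak convergence of the laws of `ℕ`-valued processes is implied by convergence of the
probabilities of cylinders. -/
lemma tendsto_of_tendsto_cylinder {μ : ℕ → ProbabilityMeasure (ℕ → ℕ)}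
    {ν : ProbabilityMeasure (ℕ → ℕ)}
    (h : ∀ k x, Tendsto (fun L => (μ L : Measure (ℕ → ℕ)) (cylinder k x)) atTop
      (𝓝 ((ν : Measure (ℕ → ℕ)) (cylinder k x)))) : Tendsto μ atTop (𝓝 ν) := by
  have hpi : IsPiSystem {s | ∃ k x, s = cylinder k x} := by
    rintro _ ⟨k, x, rfl⟩ _ ⟨k', x', rfl⟩ ⟨z, hz, hz'⟩
    refine ⟨max k k', z, ?_⟩
    rw [cylinder_eq_of_mem hz, cylinder_eq_of_mem hz']
    ext y
    refine ⟨fun hy i hi => ?_, fun hy => ⟨fun i hi => hy i (le_max_of_le_left hi),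
      fun i hi => hy i (le_max_of_le_right hi)⟩⟩
    rcases le_max_iff.1 hi with hi | hi
    · exact hy.1 i hi
    · exact hy.2 i hi
  refine hpi.tendsto_probabilityMeasure_of_tendsto_of_mem ?_ ?_ ?_
  · rintro _ ⟨k, x, rfl⟩
    exact measurableSet_cylinder k x
  · intro u hu x hx
    obtain ⟨I, v, hv, hIu⟩ := isOpen_pi_iff.1 hu x hx
    refine ⟨cylinder (I.sup id) x, ⟨_, _, rfl⟩, ?_, fun z hz => hIu fun i hi => ?_⟩
    · have hopen : IsOpen ((Set.Iic (I.sup id)).pi fun i => ({x i} : Set ℕ)) :=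
        isOpen_set_pi (Set.finite_Iic _) fun i _ => isOpen_discrete _
      exact hopen.mem_nhds fun i _ => rfl
    · rw [hz i (Finset.le_sup (f := id) hi)]
      exact (hv i hi).2
  · rintro _ ⟨k, x, rfl⟩
    rw [← ENNReal.tendsto_coe]
    simpa only [ProbabilityMeasure.ennreal_coeFn_eq_coeFn_toMeasure] using h k x

/-! ### The limiting chain -/

lemma isProbabilityMeasure_geomLaw {p : ℝ} (h0 : 0 ≤ p) (h1 : p < 1) :
    IsProbabilityMeasure (geomLaw p) := by
  refine isProbabilityMeasure_sum_smul_dirac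
    (fun n => mul_nonneg (by linarith) (pow_nonneg h0 n)) ?_
  have := (hasSum_geometric_of_lt_one h0 h1).mul_left (1 - p)
  rwa [mul_inv_cancel₀ (by linarith)] at this

/-- The law of the sum of two independent geometric variables is proportional to
`ρ₀ ^ n * harmonic ρ n`. -/
lemma map_add_geomLaw_singleton (hρ₀ : 0 ≤ ρ₀) (hρ : 0 < ρ) (h1 : ρ₀ * ρ < 1)
    (h2 : ρ₀ / ρ < 1) (n : ℕ) :
    ((geomLaw (ρ₀ * ρ)).prod (geomLaw (ρ₀ / ρ))).map (fun g => g.1 + g.2) {n} =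
      ENNReal.ofReal ((1 - ρ₀ * ρ) * (1 - ρ₀ / ρ) * (ρ₀ ^ n * harmonic ρ n)) := by
  have := isProbabilityMeasure_geomLaw (by positivity) h1
  have := isProbabilityMeasure_geomLaw (by positivity) h2
  have hset : (fun g : ℕ × ℕ => g.1 + g.2) ⁻¹' {n} =
      (Finset.HasAntidiagonal.antidiagonal n : Finset (ℕ × ℕ)) := by
    ext g; simp
  rw [Measure.map_apply (by fun_prop) (measurableSet_singleton n), hset,
    ← sum_measure_singleton]
  have hpt : ∀ g : ℕ × ℕ, ((geomLaw (ρ₀ * ρ)).prod (geomLaw (ρ₀ / ρ))) {g} =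
      ENNReal.ofReal ((1 - ρ₀ * ρ) * (ρ₀ * ρ) ^ g.1 * ((1 - ρ₀ / ρ) * (ρ₀ / ρ) ^ g.2)) := by
    rintro ⟨i, j⟩
    rw [← Set.singleton_prod_singleton, Measure.prod_prod, geomLaw, geomLaw,
      sum_smul_dirac_singleton, sum_smul_dirac_singleton, ← ENNReal.ofReal_mul
        (mul_nonneg (by linarith) (by positivity))]
  simp only [hpt]
  rw [← ENNReal.ofReal_sum_of_nonneg fun g _ => mul_nonneg
    (mul_nonneg (by linarith) (by positivity)) (mul_nonneg (by linarith) (by positivity)),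
    harmonic, Finset.mul_sum, Finset.mul_sum]
  refine congrArg _ (Finset.sum_congr rfl fun g hg => ?_)
  rw [← Finset.HasAntidiagonal.mem_antidiagonal.1 hg, pow_add, mul_pow, div_pow, one_div_pow]
  ring

/-- The limiting kernel is the Doob transform of the transfer operator by its positive harmonic
function. -/
lemma kernelQ_eq (hσ : 0 < σ) (hρ : 1 ≤ ρ) (n m : ℕ) :
    kernelQ σ ρ n m = adj σ n m * harmonic ρ m / (growth σ ρ * harmonic ρ n) := by
  have hρ0 : 0 < ρ := by linarith
  have hn := harmonic_pos hρ0 n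
  have hg := growth_pos hσ hρ0
  have hadj : adj σ n m = if m = n + 1 then 1 else if m = n then σ else
      if m + 1 = n then 1 else 0 := by
    unfold adj edgeWeight
    split_ifs <;> first | rfl | omega
  rcases hρ.eq_or_lt with rfl | h1
  · rw [kernelQ, if_pos rfl, kernelP, hadj, growth_one, harmonic_one, harmonic_one]
    have : (n : ℝ) + 1 ≠ 0 := by positivity
    have : 2 + σ ≠ 0 := by positivity
    split_ifs with ha hb hc
    · subst ha; push_cast; field_simp; ring
    · subst hb; field_simp
    · subst hc; push_cast; field_simp
    · simp
  · have hd : ρ - 1 / ρ ≠ 0 := by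
      have : 1 / ρ < 1 := (div_lt_one hρ0).2 h1
      exact (by linarith : 0 < ρ - 1 / ρ).ne'
    have hh : ∀ k, ρ ^ (k + 1) - 1 / ρ ^ (k + 1) = harmonic ρ k * (ρ - 1 / ρ) := fun k =>
      (harmonic_mul_sub hρ0.ne' k).symm
    rw [kernelQ, if_neg h1.ne', hadj]
    change (if m = n + 1 then 1 / growth σ ρ * _ else if m = n then 1 / growth σ ρ * σ else
      if m + 1 = n then 1 / growth σ ρ * _ else 0) = _
    split_ifs with ha hb hc
    · subst ha
      rw [hh, hh, mul_div_mul_right _ _ hd]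
      field_simp
    · subst hb; field_simp
    · subst hc
      rw [hh, hh, mul_div_mul_right _ _ hd]
      field_simp
    · simp

lemma kernelQ_nonneg (hσ : 0 < σ) (hρ : 1 ≤ ρ) (n m : ℕ) : 0 ≤ kernelQ σ ρ n m := by
  have hρ0 : 0 < ρ := by linarith
  have := harmonic_pos hρ0 n
  have := harmonic_pos hρ0 m
  have := growth_pos hσ hρ0
  have := adj_nonneg hσ n m
  rw [kernelQ_eq hσ hρ]
  positivity

lemma hasSum_kernelQ (hσ : 0 < σ) (hρ : 1 ≤ ρ) (n : ℕ) : HasSum (kernelQ σ ρ n) 1 := by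
  have hρ0 : 0 < ρ := by linarith
  have h := (hasSum_adj (σ := σ) (harmonic ρ) n).div_const (growth σ ρ * harmonic ρ n)
  rw [transfer_harmonic hρ0.ne', Pi.smul_apply, smul_eq_mul,
    div_self (mul_pos (growth_pos hσ hρ0) (harmonic_pos hρ0 n)).ne'] at h
  exact h.congr_fun fun m => kernelQ_eq hσ hρ n m

/-- The Doob transform telescopes along a path. -/
lemma harmonic_mul_prod_kernelQ (hσ : 0 < σ) (hρ : 1 ≤ ρ) (x : ℕ → ℕ) (k : ℕ) :
    harmonic ρ (x 0) * ∏ i ∈ Finset.range k, kernelQ σ ρ (x i) (x (i + 1)) =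
      (∏ i ∈ Finset.range k, adj σ (x i) (x (i + 1))) * harmonic ρ (x k) / growth σ ρ ^ k := by
  have hρ0 : 0 < ρ := by linarith
  induction k with
  | zero => simp
  | succ k ih =>
    have := (growth_pos hσ hρ0).ne'
    have := (harmonic_pos hρ0 (x k)).ne'
    rw [Finset.prod_range_succ, ← mul_assoc, ih, Finset.prod_range_succ, kernelQ_eq hσ hρ]
    field_simp
    ring

end Motzkin

theorem mainTheorem3 (σ ρ₀ ρ₁ : ℝ) (hσ : 0 < σ) (hρ₀ : 0 < ρ₀) (hρ₀' : ρ₀ < 1)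
    (hρ₁ : 0 ≤ ρ₁) (hρ : ρ₀ * ρ₁ < 1) :
    ∃ h : ∀ L : ℕ,
        Motzkin.normConst (fun _ => 1) (fun _ => σ) (fun _ => 1)
            (fun n => ρ₀ ^ n) (fun n => ρ₁ ^ n) L ≠ 0 ∧
          Motzkin.normConst (fun _ => 1) (fun _ => σ) (fun _ => 1)
            (fun n => ρ₀ ^ n) (fun n => ρ₁ ^ n) L ≠ ∞,
      ∃ μ : ProbabilityMeasure (ℕ → ℕ),
        Motzkin.IsMarkovChain (μ : Measure (ℕ → ℕ)) (fun k z => z k)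
            (Motzkin.kernelQ σ (max 1 ρ₁)) ∧
          (μ : Measure (ℕ → ℕ)).map (fun z => z 0) =
            ((Motzkin.geomLaw (ρ₀ * max 1 ρ₁)).prod (Motzkin.geomLaw (ρ₀ / max 1 ρ₁))).map
              (fun g => g.1 + g.2) ∧
          Tendsto
            (fun L : ℕ => Motzkin.leftBoundaryLaw (fun _ => 1) (fun _ => σ) (fun _ => 1)
              (fun n => ρ₀ ^ n) (fun n => ρ₁ ^ n) L (h L))
            atTop (𝓝 μ) := by
  have hm : 1 ≤ max 1 ρ₁ := le_max_left _ _
  have hm0 : 0 < max 1 ρ₁ := by positivity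
  have h1 : ρ₀ * max 1 ρ₁ < 1 := by
    rcases max_choice 1 ρ₁ with h | h <;> rw [h] <;> linarith
  have h2 : ρ₀ / max 1 ρ₁ < 1 := (div_lt_one hm0).2 (by linarith)
  have := Motzkin.isProbabilityMeasure_geomLaw (by positivity) h1
  have := Motzkin.isProbabilityMeasure_geomLaw (by positivity) h2
  have := Measure.isProbabilityMeasure_map (f := fun g : ℕ × ℕ => g.1 + g.2)
    (μ := (Motzkin.geomLaw (ρ₀ * max 1 ρ₁)).prod (Motzkin.geomLaw (ρ₀ / max 1 ρ₁)))
    (by fun_prop)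
  obtain ⟨μ, hμ, hμ0⟩ := Motzkin.exists_isMarkovChain (Motzkin.kernelQ_nonneg hσ hm)
    (Motzkin.hasSum_kernelQ hσ hm)
    (((Motzkin.geomLaw (ρ₀ * max 1 ρ₁)).prod (Motzkin.geomLaw (ρ₀ / max 1 ρ₁))).map
      (fun g => g.1 + g.2))
  refine ⟨fun L => ?_, μ, hμ, hμ0, Motzkin.tendsto_of_tendsto_cylinder fun k x => ?_⟩
  · rw [Motzkin.normConst_eq hσ hρ₀ hρ₀' hρ₁ hρ]
    exact ⟨(ENNReal.ofReal_pos.2 (Motzkin.partition_pos hσ hρ₀ hρ₀' hρ₁ hρ L)).ne',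
      ENNReal.ofReal_ne_top⟩
  · rw [← tendsto_add_atTop_iff_nat k]
    simp only [Motzkin.leftBoundaryLaw_cylinder hσ hρ₀ hρ₀' hρ₁ hρ]
    have hK : 0 ≤ (1 - ρ₀ * max 1 ρ₁) * (1 - ρ₀ / max 1 ρ₁) :=
      mul_nonneg (by linarith) (by linarith)
    rw [hμ.cylinder_eq, hμ0, Motzkin.map_add_geomLaw_singleton hρ₀.le hm0 h1 h2,
      ← ENNReal.ofReal_mul (mul_nonneg hK
        (mul_nonneg (by positivity) (Motzkin.harmonic_pos hm0 _).le))]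
    refine ENNReal.tendsto_ofReal ?_
    have h := (Motzkin.tendsto_endSum_div_partition_add hσ hρ₀ hρ₀' hρ₁ hρ (x k) k).const_mul
      (ρ₀ ^ x 0 * ∏ i ∈ Finset.range k, Motzkin.adj σ (x i) (x (i + 1)))
    convert h using 2
    linear_combination (1 - ρ₀ * max 1 ρ₁) * (1 - ρ₀ / max 1 ρ₁) * ρ₀ ^ x 0 *
      Motzkin.harmonic_mul_prod_kernelQ hσ hm x k
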